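/- Let $p$ be a prime, let $C_p$ be a cyclic group of order $p$, and let $T$ be a $C_p$-Tambara functor with restriction $\mathrm{res}\colon T(C_p/C_p)\to T(C_p/e)$ and transfer and norm $\mathrm{tr},\mathrm{nm}\colon T(C_p/e)\to T(C_p/C_p)$. Let $\tau\subseteq T(C_p/C_p)$ be the image of $\mathrm{tr}$, which is an ideal, and let $\Phi^{C_p}T := T(C_p/C_p)/\tau$ be the ring of geometric fixed points. The assignment $x\mapsto \mathrm{nm}(x)+\tau$ is a ring homomorphism $\mathrm{nm}\colon T(C_p/e)\to\Phi^{C_p}T$. The ghost $\mathrm{gh}(T)$ is the $C_p$-Tambara functor with $\mathrm{gh}(T)(C_p/e)=T(C_p/e)$ (with the same $C_p$-action) and $\mathrm{gh}(T)(C_p/C_p)=T(C_p/e)^{C_p}\times\Phi^{C_p}T$, with restriction $(x,y)\mapsto x$, transfer $x\mapsto\big(\sum_{g\in C_p}g\cdot x,\,0\big)$ and norm $x\mapsto\big(\prod_{g\in C_p}g\cdot x,\ \mathrm{nm}(x)+\tau\big)$. An ideal $I$ of a $C_p$-Tambara functor is a family of ideals $I(C_p/H)\subseteq T(C_p/H)$,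 $H\le C_p$, closed under restriction, transfer, norm and conjugation; containment of ideals is levelwise, and $IJ$ is the ideal generated by the products $I(C_p/H)J(C_p/H)$. A proper ideal $P$ is prime if $IJ\subseteq P$ implies $I\subseteq P$ or $J\subseteq P$ for all ideals $I,J$. The Krull dimension $\dim$ of a Tambara functor (respectively, of a commutative ring) is the supremum of the integers $k$ for which there is a chain $\mathfrak p_0\subsetneq\mathfrak p_1\subsetneq\dots\subsetneq\mathfrak p_k$ of prime ideals, with $\dim(0)=-\infty$. **Theorem.** Suppose that $\mathrm{nm}\colon T(C_p/e)\to\Phi^{C_p}T$ is an integral ring homomorphism. Then $$\dim(T)\le\dim(\mathrm{gh}(T))\le\max\big(\dim T(C_p/e),\ \dim(\Phi^{C_p}T)+1\big).$$ If, in addition, $\mathrm{nm}\colon T(C_p/e)\to\Phi^{C_p}T$ is injective, then $\dim T(C_p/e)=\dim\Phi^{C_p}T$ and $\dim(T)\le\dim T(C_p/e)+1$. -/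

import Mathlib

set_option linter.unusedSectionVars false

universe u

/-! ### Finite `G`-sets: the maps and constructions that enter the definition -/

namespace GSet

variable {G : Type} [Group G]

/-- The inclusion `X → X ⊔ Y`. -/
def inl (X Y : Type) [MulAction G X] [MulAction G Y] : X →[G] X ⊕ Y where
  toFun := Sum.inl
  map_smul' _ _ := rfl

/-- The inclusion `Y → X ⊔ Y`. -/
def inr (X Y : Type) [MulAction G X] [MulAction G Y] : Y →[G] X ⊕ Y where
  toFun := Sum.inr
  map_smul' _ _ := rfl

/-- The map `X ⊔ Y → Z` given by `f` and `g`. -/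
def desc {X Y Z : Type} [MulAction G X] [MulAction G Y] [MulAction G Z]
    (f : X →[G] Z) (g : Y →[G] Z) : X ⊕ Y →[G] Z where
  toFun := Sum.elim f g
  map_smul' m x := by cases x <;> simp

/-- The fold map `∇ : X ⊔ X → X`. -/
def fold (X : Type) [MulAction G X] : X ⊕ X →[G] X :=
  desc (MulActionHom.id G) (MulActionHom.id G)

/-- The square with sides `p₁ : P → X`, `p₂ : P → Y`, `f : X → Z`, `g : Y → Z` is cartesian. -/
structure IsPullbackSq {P X Y Z : Type} [MulAction G P] [MulAction G X] [MulAction G Y]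
    [MulAction G Z] (p₁ : P →[G] X) (p₂ : P →[G] Y) (f : X →[G] Z) (g : Y →[G] Z) : Prop where
  comm : ∀ a, f (p₁ a) = g (p₂ a)
  exists_unique : ∀ x y, f x = g y → ∃! a, p₁ a = x ∧ p₂ a = y

/-- The dependent product `Π_f A` of `q : A → X` along `f : X → Y`: pairs of a point `y` of `Y`
and a section of `q` over the fibre `f⁻¹(y)`. -/
structure DepProd {A X Y : Type} [MulAction G A] [MulAction G X] [MulAction G Y]
    (q : A →[G] X) (f : X →[G] Y) where
  pt : Y
  sec : ∀ x : X, f x = pt → A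
  sec_spec : ∀ x h, q (sec x h) = x

namespace DepProd

variable {A X Y : Type} [MulAction G A] [MulAction G X] [MulAction G Y]
  {q : A →[G] X} {f : X →[G] Y}

theorem ext' {s t : DepProd q f} (h : s.pt = t.pt)
    (h' : ∀ x hs ht, s.sec x hs = t.sec x ht) : s = t := by
  rcases s with ⟨y, s, hs⟩
  rcases t with ⟨y', t, ht⟩
  obtain rfl : y = y' := h
  obtain rfl : s = t := by
    funext x hx
    exact h' x hx hx
  rfl

theorem sec_congr {s t : DepProd q f} (h : s = t) {x x' : X} (hx : x = x') (hs : f x = s.pt)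
    (ht : f x' = t.pt) : s.sec x hs = t.sec x' ht := by
  subst h
  subst hx
  rfl

instance [Finite A] [Finite X] [Finite Y] : Finite (DepProd q f) := by
  refine Finite.of_injective
    (β := Σ y : Y, ({x : X // f x = y} → A)) (fun s => ⟨s.pt, fun x => s.sec x.1 x.2⟩) ?_
  rintro ⟨y, s, hs⟩ ⟨y', t, ht⟩ h
  obtain rfl : y = y' := congrArg Sigma.fst h
  have h2 := eq_of_heq (Sigma.mk.inj h).2
  refine ext' rfl fun x h1 _ => ?_
  exact congrFun h2 ⟨x, h1⟩

/-- `G` acts on sections by conjugation: `(g • s)(x) = g • s(g⁻¹ • x)`. -/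
instance : MulAction G (DepProd q f) where
  smul g s :=
    { pt := g • s.pt
      sec := fun x h => g • s.sec (g⁻¹ • x) (by rw [map_smul, h, inv_smul_smul])
      sec_spec := fun x h => by rw [map_smul, s.sec_spec, smul_inv_smul] }
  one_smul s := by
    refine ext' (one_smul G s.pt) fun x h1 h2 => ?_
    change (1 : G) • s.sec ((1 : G)⁻¹ • x) _ = _
    rw [one_smul]
    exact sec_congr rfl (by simp) _ _
  mul_smul g h s := by
    refine ext' (mul_smul g h s.pt) fun x h1 h2 => ?_
    change (g * h) • s.sec ((g * h)⁻¹ • x) _ = g • h • s.sec (h⁻¹ • g⁻¹ • x) _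
    rw [mul_smul]
    congr 2
    exact sec_congr rfl (by simp [mul_smul]) _ _

theorem smul_pt (g : G) (s : DepProd q f) : (g • s).pt = g • s.pt := rfl

theorem smul_sec (g : G) (s : DepProd q f) (x : X) (h : f x = s.pt) (h' : f (g • x) = (g • s).pt) :
    (g • s).sec (g • x) h' = g • s.sec x h := by
  change g • s.sec (g⁻¹ • g • x) _ = _
  congr 1
  exact sec_congr rfl (by simp) _ _

/-- The structure map `Π_f A → Y`. -/
def proj (q : A →[G] X) (f : X →[G] Y) : DepProd q f →[G] Y where
  toFun := pt
  map_smul' _ _ := rfl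

/-- The fibre product `X ×_Y Π_f A`. -/
def Total (q : A →[G] X) (f : X →[G] Y) : Type :=
  {e : X × DepProd q f // f e.1 = e.2.pt}

instance [Finite A] [Finite X] [Finite Y] : Finite (Total q f) :=
  inferInstanceAs (Finite {e : X × DepProd q f // f e.1 = e.2.pt})

instance : MulAction G (Total q f) where
  smul g e := ⟨g • e.1, by
    change f (g • e.1.1) = g • e.1.2.pt
    rw [map_smul, e.2]⟩
  one_smul e := Subtype.ext (one_smul G e.1)
  mul_smul g h e := Subtype.ext (mul_smul g h e.1)

/-- The projection `X ×_Y Π_f A → Π_f A`. -/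
def totalSnd (q : A →[G] X) (f : X →[G] Y) : Total q f →[G] DepProd q f where
  toFun e := e.1.2
  map_smul' _ _ := rfl

/-- The evaluation `X ×_Y Π_f A → A`, `(x, s) ↦ s(x)`. -/
def eval (q : A →[G] X) (f : X →[G] Y) : Total q f →[G] A where
  toFun e := e.1.2.sec e.1.1 e.2
  map_smul' g e := smul_sec g e.1.2 e.1.1 e.2 _

end DepProd

end GSet

/-! ### Tambara functors -/

open GSet in
/-- A `G`-Tambara functor, presented by its restrictions `res f`, transfers `tr f` and norms `nm f`
along the maps `f` of finite `G`-sets; these are the values of the functor on the bispans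
`R_f`, `T_f`, `N_f`, and every bispan is of the form `T_h N_g R_f`. The axioms are the composition
rules for bispans (functoriality, base change along cartesian squares, distributivity along
exponential diagrams), the preservation of finite products, and the requirement that each value is
a commutative ring under the operations `0_X`, `1_X`, `α_X`, `μ_X`. -/
structure TambaraFunctor (G : Type) [Group G] where
  /-- the value on a finite `G`-set -/
  obj : (X : Type) → [Finite X] → [MulAction G X] → Type u
  [ring : (X : Type) → [Finite X] → [MulAction G X] → CommRing (obj X)]
  res : {X Y : Type} → [Finite X] → [MulAction G X] → [Finite Y] → [MulAction G Y] →
    (X →[G] Y) → obj Y → obj X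
  tr : {X Y : Type} → [Finite X] → [MulAction G X] → [Finite Y] → [MulAction G Y] →
    (X →[G] Y) → obj X → obj Y
  nm : {X Y : Type} → [Finite X] → [MulAction G X] → [Finite Y] → [MulAction G Y] →
    (X →[G] Y) → obj X → obj Y
  res_id : ∀ {X : Type} [Finite X] [MulAction G X] (a : obj X), res (MulActionHom.id G) a = a
  tr_id : ∀ {X : Type} [Finite X] [MulAction G X] (a : obj X), tr (MulActionHom.id G) a = a
  nm_id : ∀ {X : Type} [Finite X] [MulAction G X] (a : obj X), nm (MulActionHom.id G) a = a
  res_comp : ∀ {X Y Z : Type} [Finite X] [MulAction G X] [Finite Y] [MulAction G Y] [Finite Z]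
    [MulAction G Z] (g : Y →[G] Z) (f : X →[G] Y) (a : obj Z),
    res (g.comp f) a = res f (res g a)
  tr_comp : ∀ {X Y Z : Type} [Finite X] [MulAction G X] [Finite Y] [MulAction G Y] [Finite Z]
    [MulAction G Z] (g : Y →[G] Z) (f : X →[G] Y) (a : obj X),
    tr (g.comp f) a = tr g (tr f a)
  nm_comp : ∀ {X Y Z : Type} [Finite X] [MulAction G X] [Finite Y] [MulAction G Y] [Finite Z]
    [MulAction G Z] (g : Y →[G] Z) (f : X →[G] Y) (a : obj X),
    nm (g.comp f) a = nm g (nm f a)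
  /-- base change for transfers -/
  res_tr : ∀ {P X Y Z : Type} [Finite P] [MulAction G P] [Finite X] [MulAction G X] [Finite Y]
    [MulAction G Y] [Finite Z] [MulAction G Z] (p₁ : P →[G] X) (p₂ : P →[G] Y) (f : X →[G] Z)
    (g : Y →[G] Z), IsPullbackSq p₁ p₂ f g → ∀ a : obj X, res g (tr f a) = tr p₂ (res p₁ a)
  /-- base change for norms -/
  res_nm : ∀ {P X Y Z : Type} [Finite P] [MulAction G P] [Finite X] [MulAction G X] [Finite Y]
    [MulAction G Y] [Finite Z] [MulAction G Z] (p₁ : P →[G] X) (p₂ : P →[G] Y) (f : X →[G] Z)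
    (g : Y →[G] Z), IsPullbackSq p₁ p₂ f g → ∀ a : obj X, res g (nm f a) = nm p₂ (res p₁ a)
  /-- distributivity: the norm of a transfer, through the exponential diagram of `q` and `f` -/
  nm_tr : ∀ {A X Y : Type} [Finite A] [MulAction G A] [Finite X] [MulAction G X] [Finite Y]
    [MulAction G Y] (q : A →[G] X) (f : X →[G] Y) (a : obj A),
    nm f (tr q a) = tr (DepProd.proj q f) (nm (DepProd.totalSnd q f) (res (DepProd.eval q f) a))
  /-- preservation of the empty product -/
  subsingleton_obj : ∀ (X : Type) [Finite X] [MulAction G X] [IsEmpty X], Subsingleton (obj X)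
  /-- preservation of binary products -/
  bijective_res : ∀ (X Y : Type) [Finite X] [MulAction G X] [Finite Y] [MulAction G Y],
    Function.Bijective fun a : obj (X ⊕ Y) => (res (inl X Y) a, res (inr X Y) a)
  /-- `0_X` is the transfer along `∅ → X` -/
  tr_empty : ∀ {E X : Type} [Finite E] [MulAction G E] [Finite X] [MulAction G X] [IsEmpty E]
    (f : E →[G] X) (a : obj E), tr f a = 0
  /-- `1_X` is the norm along `∅ → X` -/
  nm_empty : ∀ {E X : Type} [Finite E] [MulAction G E] [Finite X] [MulAction G X] [IsEmpty E]
    (f : E →[G] X) (a : obj E), nm f a = 1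
  /-- `α_X` is the transfer along the fold map -/
  tr_fold : ∀ {X : Type} [Finite X] [MulAction G X] (a : obj (X ⊕ X)),
    tr (fold X) a = res (inl X X) a + res (inr X X) a
  /-- `μ_X` is the norm along the fold map -/
  nm_fold : ∀ {X : Type} [Finite X] [MulAction G X] (a : obj (X ⊕ X)),
    nm (fold X) a = res (inl X X) a * res (inr X X) a

attribute [instance] TambaraFunctor.ring

/-! ### First consequences of the axioms -/

namespace GSet

variable {G : Type} [Group G] {X Y Z X' Y' : Type} [MulAction G X] [MulAction G Y] [MulAction G Z]
  [MulAction G X'] [MulAction G Y']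

/-- The disjoint union of two maps. -/
def sumMap (f : X →[G] X') (g : Y →[G] Y') : X ⊕ Y →[G] X' ⊕ Y' :=
  desc ((inl X' Y').comp f) ((inr X' Y').comp g)

/-- The inverse of a bijective `G`-map. -/
noncomputable def inv (f : X →[G] Y) (hf : Function.Bijective f) : Y →[G] X where
  toFun := (Equiv.ofBijective f hf).symm
  map_smul' g y := by
    apply hf.1
    simp only [map_smul]
    change f ((Equiv.ofBijective f hf).symm (g • y)) = g • f ((Equiv.ofBijective f hf).symm y)
    rw [Equiv.ofBijective_apply_symm_apply f hf, Equiv.ofBijective_apply_symm_apply f hf]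

theorem apply_inv (f : X →[G] Y) (hf : Function.Bijective f) (y : Y) : f (inv f hf y) = y :=
  Equiv.ofBijective_apply_symm_apply f hf y

theorem inv_apply (f : X →[G] Y) (hf : Function.Bijective f) (x : X) : inv f hf (f x) = x :=
  Equiv.ofBijective_symm_apply_apply f hf x

theorem isPullbackSq_inv (f : X →[G] Y) (hf : Function.Bijective f) :
    IsPullbackSq (inv f hf) (MulActionHom.id G) f (MulActionHom.id G) where
  comm y := apply_inv f hf y
  exists_unique x y h := ⟨y, ⟨by rw [← show f x = y from h, inv_apply], rfl⟩, fun _ h' => h'.2⟩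

theorem isPullbackSq_inl
    (f : X →[G] X') (g : Y →[G] Y') :
    IsPullbackSq (inl X Y) f (sumMap f g) (inl X' Y') where
  comm _ := rfl
  exists_unique := by
    rintro (x | y) x' h
    · exact ⟨x, ⟨rfl, Sum.inl_injective h⟩, fun z hz => Sum.inl_injective hz.1⟩
    · exact absurd h Sum.inr_ne_inl

theorem isPullbackSq_inr
    (f : X →[G] X') (g : Y →[G] Y') :
    IsPullbackSq (inr X Y) g (sumMap f g) (inr X' Y') where
  comm _ := rfl
  exists_unique := by
    rintro (x | y) x' h
    · exact absurd h Sum.inl_ne_inr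
    · exact ⟨y, ⟨rfl, Sum.inr_injective h⟩, fun z hz => Sum.inr_injective hz.1⟩

theorem isPullbackSq_fold (f : X →[G] Y) :
    IsPullbackSq (sumMap f f) (fold X) (fold Y) f where
  comm := by rintro (x | x) <;> rfl
  exists_unique := by
    rintro (y | y) x h
    · refine ⟨Sum.inl x, ⟨congrArg Sum.inl (Eq.symm h), rfl⟩, ?_⟩
      rintro (z | z) ⟨h1, h2⟩
      · exact congrArg Sum.inl h2
      · exact absurd h1 Sum.inr_ne_inl
    · refine ⟨Sum.inr x, ⟨congrArg Sum.inr (Eq.symm h), rfl⟩, ?_⟩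
      rintro (z | z) ⟨h1, h2⟩
      · exact absurd h1 Sum.inl_ne_inr
      · exact congrArg Sum.inr h2

end GSet

namespace TambaraFunctor

open GSet

variable {G : Type} [Group G] (T : TambaraFunctor.{u} G)
  {X Y Z : Type} [Finite X] [MulAction G X] [Finite Y] [MulAction G Y] [Finite Z] [MulAction G Z]

theorem tr_of_bijective (f : X →[G] Y) (hf : Function.Bijective f) (a : T.obj X) :
    T.tr f a = T.res (inv f hf) a := by
  have := T.res_tr _ _ _ _ (isPullbackSq_inv f hf) a
  rwa [T.res_id, T.tr_id] at this

theorem nm_of_bijective (f : X →[G] Y) (hf : Function.Bijective f) (a : T.obj X) :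
    T.nm f a = T.res (inv f hf) a := by
  have := T.res_nm _ _ _ _ (isPullbackSq_inv f hf) a
  rwa [T.res_id, T.nm_id] at this

theorem tr_res_of_bijective (f : X →[G] Y) (hf : Function.Bijective f) (a : T.obj Y) :
    T.tr f (T.res f a) = a := by
  rw [tr_of_bijective T f hf, ← T.res_comp]
  have : f.comp (inv f hf) = MulActionHom.id G := by
    ext y
    exact apply_inv f hf y
  rw [this, T.res_id]

theorem nm_res_of_bijective (f : X →[G] Y) (hf : Function.Bijective f) (a : T.obj Y) :
    T.nm f (T.res f a) = a := by
  rw [nm_of_bijective T f hf, ← T.res_comp]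
  have : f.comp (inv f hf) = MulActionHom.id G := by
    ext y
    exact apply_inv f hf y
  rw [this, T.res_id]

theorem exists_pair (a : T.obj X) (b : T.obj Y) :
    ∃ z : T.obj (X ⊕ Y), T.res (inl X Y) z = a ∧ T.res (inr X Y) z = b := by
  obtain ⟨z, hz⟩ := (T.bijective_res X Y).2 (a, b)
  exact ⟨z, congrArg Prod.fst hz, congrArg Prod.snd hz⟩

theorem tr_sum (h : X ⊕ Y →[G] Z) (z : T.obj (X ⊕ Y)) :
    T.tr h z = T.tr (h.comp (inl X Y)) (T.res (inl X Y) z) +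
      T.tr (h.comp (inr X Y)) (T.res (inr X Y) z) := by
  have : h = (fold Z).comp (sumMap (h.comp (inl X Y)) (h.comp (inr X Y))) := by
    ext x
    cases x <;> rfl
  conv_lhs => rw [this]
  rw [T.tr_comp, T.tr_fold, T.res_tr _ _ _ _ (isPullbackSq_inl _ _),
    T.res_tr _ _ _ _ (isPullbackSq_inr _ _)]

theorem nm_sum (h : X ⊕ Y →[G] Z) (z : T.obj (X ⊕ Y)) :
    T.nm h z = T.nm (h.comp (inl X Y)) (T.res (inl X Y) z) *
      T.nm (h.comp (inr X Y)) (T.res (inr X Y) z) := by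
  have : h = (fold Z).comp (sumMap (h.comp (inl X Y)) (h.comp (inr X Y))) := by
    ext x
    cases x <;> rfl
  conv_lhs => rw [this]
  rw [T.nm_comp, T.nm_fold, T.res_nm _ _ _ _ (isPullbackSq_inl _ _),
    T.res_nm _ _ _ _ (isPullbackSq_inr _ _)]

theorem tr_add (f : X →[G] Y) (a b : T.obj X) : T.tr f (a + b) = T.tr f a + T.tr f b := by
  obtain ⟨z, rfl, rfl⟩ := T.exists_pair a b
  rw [← T.tr_fold, ← T.tr_comp, T.tr_sum]
  rfl

theorem nm_mul (f : X →[G] Y) (a b : T.obj X) : T.nm f (a * b) = T.nm f a * T.nm f b := by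
  obtain ⟨z, rfl, rfl⟩ := T.exists_pair a b
  rw [← T.nm_fold, ← T.nm_comp, T.nm_sum]
  rfl

theorem res_add (f : X →[G] Y) (a b : T.obj Y) : T.res f (a + b) = T.res f a + T.res f b := by
  obtain ⟨z, rfl, rfl⟩ := T.exists_pair a b
  rw [← T.tr_fold, T.res_tr _ _ _ _ (isPullbackSq_fold f), T.tr_fold, ← T.res_comp, ← T.res_comp,
    ← T.res_comp, ← T.res_comp]
  rfl

theorem res_mul (f : X →[G] Y) (a b : T.obj Y) : T.res f (a * b) = T.res f a * T.res f b := by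
  obtain ⟨z, rfl, rfl⟩ := T.exists_pair a b
  rw [← T.nm_fold, T.res_nm _ _ _ _ (isPullbackSq_fold f), T.nm_fold, ← T.res_comp, ← T.res_comp,
    ← T.res_comp, ← T.res_comp]
  rfl

instance : MulAction G Empty where
  smul _ x := x
  one_smul _ := rfl
  mul_smul _ _ _ := rfl

/-- The map `∅ → X`. -/
def fromEmpty (X : Type) [MulAction G X] : Empty →[G] X where
  toFun := Empty.elim
  map_smul' _ x := x.elim

theorem nm_one (f : X →[G] Y) : T.nm f 1 = 1 := by
  rw [← T.nm_empty (fromEmpty X) 0, ← T.nm_comp, T.nm_empty]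

theorem res_one (f : X →[G] Y) : T.res f 1 = 1 := by
  have h : IsPullbackSq (MulActionHom.id G) (fromEmpty X) (fromEmpty Y) f :=
    ⟨fun a => a.elim, fun a => a.elim⟩
  rw [← T.nm_empty (fromEmpty Y) 0, T.res_nm _ _ _ _ h, T.nm_empty]

/-- Restriction as a ring homomorphism. -/
def resHom (f : X →[G] Y) : T.obj Y →+* T.obj X where
  toFun := T.res f
  map_one' := T.res_one f
  map_mul' := T.res_mul f
  map_zero' := by
    have := T.res_add f 0 0
    rwa [add_zero, left_eq_add] at this
  map_add' := T.res_add f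

/-! ### Ideals, prime ideals and Krull dimension -/

/-- An ideal of a Tambara functor: an ideal of `T(G/H)` for each subgroup `H`, closed under the
restrictions, transfers and norms along all equivariant maps `G/K → G/H`. (Each such map is a
conjugation isomorphism followed by a canonical projection.) -/
@[ext]
structure TambaraIdeal [Finite G] where
  level : (H : Subgroup G) → Ideal (T.obj (G ⧸ H))
  res_mem : ∀ {K H : Subgroup G} (f : G ⧸ K →[G] G ⧸ H) {a}, a ∈ level H → T.res f a ∈ level K
  tr_mem : ∀ {K H : Subgroup G} (f : G ⧸ K →[G] G ⧸ H) {a}, a ∈ level K → T.tr f a ∈ level H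
  nm_mem : ∀ {K H : Subgroup G} (f : G ⧸ K →[G] G ⧸ H) {a}, a ∈ level K → T.nm f a ∈ level H

namespace TambaraIdeal

variable {T} [Finite G]

/-- Containment of ideals is levelwise. -/
instance : PartialOrder T.TambaraIdeal :=
  PartialOrder.lift TambaraIdeal.level fun _ _ h => TambaraIdeal.ext h

/-- The ideal generated by a levelwise collection of subsets: the intersection of all ideals that
contain it. -/
def span (S : (H : Subgroup G) → Set (T.obj (G ⧸ H))) : T.TambaraIdeal where
  level H := ⨅ (J : T.TambaraIdeal) (_ : ∀ H', S H' ⊆ J.level H'), J.level H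
  res_mem f a ha := by
    simp only [Ideal.mem_iInf] at ha ⊢
    exact fun J hJ => J.res_mem f (ha J hJ)
  tr_mem f a ha := by
    simp only [Ideal.mem_iInf] at ha ⊢
    exact fun J hJ => J.tr_mem f (ha J hJ)
  nm_mem f a ha := by
    simp only [Ideal.mem_iInf] at ha ⊢
    exact fun J hJ => J.nm_mem f (ha J hJ)

/-- The product `IJ`: the ideal generated by the levelwise products `I(G/H) J(G/H)`. -/
instance : Mul T.TambaraIdeal where
  mul I J := span fun H => (I.level H * J.level H : Ideal (T.obj (G ⧸ H)))

/-- A proper ideal `P` is prime if `IJ ⊆ P` implies `I ⊆ P` or `J ⊆ P`. -/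
structure IsPrime (P : T.TambaraIdeal) : Prop where
  proper : ∃ H, P.level H ≠ ⊤
  le_or_le : ∀ I J : T.TambaraIdeal, I * J ≤ P → I ≤ P ∨ J ≤ P

end TambaraIdeal

/-- The poset of prime ideals of `T`. -/
def Spec [Finite G] : Type u := {P : T.TambaraIdeal // P.IsPrime}

instance [Finite G] : PartialOrder T.Spec :=
  inferInstanceAs (PartialOrder {P : T.TambaraIdeal // P.IsPrime})

/-- The Krull dimension of `T`: the supremum of the lengths of strictly increasing chains of prime
ideals, and `⊥ = -∞` if there are none. -/
noncomputable def krullDim [Finite G] : WithBot ℕ∞ := Order.krullDim T.Spec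

end TambaraFunctor

/-! ### Geometric fixed points -/

namespace GSet

variable {G : Type} [Group G]

/-- The canonical projection `G/K → G/H` for `K ≤ H`. -/
def quot {K H : Subgroup G} (h : K ≤ H) : G ⧸ K →[G] G ⧸ H where
  toFun := Subgroup.quotientMapOfLE h
  map_smul' g x := by
    induction x using QuotientGroup.induction_on
    rfl

/-- Right translation `x ↦ x g` on `G/e`. -/
def rightMul (g : G) : G ⧸ (⊥ : Subgroup G) →[G] G ⧸ (⊥ : Subgroup G) where
  toFun := Quotient.map' (· * g) fun a b h => by
    rw [QuotientGroup.leftRel_apply, Subgroup.mem_bot, inv_mul_eq_one] at h ⊢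
    rw [h]
  map_smul' m x := by
    induction x using QuotientGroup.induction_on with
    | H x => exact congrArg QuotientGroup.mk (mul_assoc m x g)

theorem rightMul_one : rightMul (1 : G) = MulActionHom.id G := by
  ext x
  induction x using QuotientGroup.induction_on with
  | H x => exact congrArg QuotientGroup.mk (mul_one x)

theorem rightMul_mul (g h : G) : rightMul (g * h) = (rightMul h).comp (rightMul g) := by
  ext x
  induction x using QuotientGroup.induction_on with
  | H x => exact congrArg QuotientGroup.mk (mul_assoc x g h).symm

instance : Subsingleton (G ⧸ (⊤ : Subgroup G)) := QuotientGroup.subsingleton_quotient_top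

theorem exists_hom_of_free {F : Type} [MulAction G F] (hF : ∀ (g : G) (x : F), g • x = x → g = 1) :
    ∃ _f : F →[G] G ⧸ (⊥ : Subgroup G), True := by
  have h : ∀ x : F, ∃ g : G,
      g • (Quotient.mk (MulAction.orbitRel G F) x).out = x := fun x =>
    MulAction.orbitRel_apply.1 ((MulAction.orbitRel G F).symm (Quotient.mk_out x))
  choose c hc using h
  refine ⟨⟨fun x => (c x : G ⧸ (⊥ : Subgroup G)), fun g x => ?_⟩, trivial⟩
  change ((c (g • x) : G) : G ⧸ (⊥ : Subgroup G)) = ((g * c x : G) : G ⧸ (⊥ : Subgroup G))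
  congr 1
  have h1 := hc (g • x)
  have h2 : Quotient.mk (MulAction.orbitRel G F) (g • x) = Quotient.mk _ x :=
    Quotient.sound ⟨g, rfl⟩
  rw [h2] at h1
  have h3 : (g * c x)⁻¹ • c (g • x) • (Quotient.mk (MulAction.orbitRel G F) x).out =
      (Quotient.mk (MulAction.orbitRel G F) x).out := by
    rw [h1, inv_smul_eq_iff, mul_smul, hc]
  rw [smul_smul] at h3
  exact (inv_mul_eq_one.1 (hF _ _ h3)).symm

/-- In a group of prime order, an element that moves a point is in no proper stabilizer. -/
theorem eq_one_of_smul_eq (hG : (Nat.card G).Prime) {X : Type} [MulAction G X] {x : X}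
    (hx : x ∉ MulAction.fixedPoints G X) {g : G} (h : g • x = x) : g = 1 := by
  have := Fact.mk hG
  rcases (MulAction.stabilizer G x).eq_bot_or_eq_top_of_prime_card with h' | h'
  · have : g ∈ MulAction.stabilizer G x := h
    rwa [h', Subgroup.mem_bot] at this
  · refine absurd (fun m => ?_) hx
    have : m ∈ MulAction.stabilizer G x := by
      rw [h']
      trivial
    exact this

end GSet

namespace TambaraFunctor

open GSet

variable {G : Type} [Group G] [Finite G] (T : TambaraFunctor.{u} G)

/-- The underlying ring `T(G/e)`. -/
abbrev Bot : Type u := T.obj (G ⧸ (⊥ : Subgroup G))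

/-- The ring `T(G/G)`. -/
abbrev Top : Type u := T.obj (G ⧸ (⊤ : Subgroup G))

/-- The action of `G` on `T(G/e)` by conjugation. -/
instance : MulSemiringAction G T.Bot where
  smul g a := T.res (rightMul g) a
  one_smul a := by
    change T.res (rightMul 1) a = a
    rw [rightMul_one, T.res_id]
  mul_smul g h a := by
    change T.res (rightMul (g * h)) a = T.res (rightMul g) (T.res (rightMul h) a)
    rw [rightMul_mul, T.res_comp]
  smul_zero g := map_zero (T.resHom (rightMul g))
  smul_add g := map_add (T.resHom (rightMul g))
  smul_one g := map_one (T.resHom (rightMul g))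
  smul_mul g := map_mul (T.resHom (rightMul g))

theorem tr_mem_range_of_free {F : Type} [Finite F] [MulAction G F]
    (hF : ∀ (g : G) (x : F), g • x = x → g = 1) (f : F →[G] G ⧸ (⊤ : Subgroup G)) (a : T.obj F) :
    T.tr f a ∈ Set.range (T.tr (quot (bot_le : (⊥ : Subgroup G) ≤ ⊤))) := by
  obtain ⟨h, -⟩ := exists_hom_of_free hF
  have : f = (quot bot_le).comp h := by
    ext x
    exact Subsingleton.elim _ _
  exact ⟨T.tr h a, by rw [this, T.tr_comp]⟩

theorem mul_tr_mem_range (b : T.Top) (a : T.Bot) :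
    b * T.tr (quot bot_le) a ∈ Set.range (T.tr (quot (bot_le : (⊥ : Subgroup G) ≤ ⊤))) := by
  obtain ⟨z, rfl, rfl⟩ := T.exists_pair b a
  set q := sumMap (MulActionHom.id G : G ⧸ (⊤ : Subgroup G) →[G] G ⧸ (⊤ : Subgroup G))
    (quot (bot_le : (⊥ : Subgroup G) ≤ ⊤)) with hq
  have h1 : T.res (inl _ _) z = T.res (inl _ _) (T.tr q z) := by
    rw [T.res_tr _ _ _ _ (isPullbackSq_inl _ _), T.tr_id]
  rw [h1, ← T.res_tr _ _ _ _ (isPullbackSq_inr (MulActionHom.id G) _), ← hq, ← T.nm_fold, T.nm_tr]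
  refine T.tr_mem_range_of_free (fun g d hd => ?_) _ _
  have hd1 : fold (G := G) (G ⧸ (⊤ : Subgroup G)) (Sum.inr d.pt) = d.pt := rfl
  have hs := d.sec_spec _ hd1
  have hg := DepProd.smul_sec g d (Sum.inr d.pt) hd1 (Subsingleton.elim _ _)
  rcases hx : d.sec (Sum.inr d.pt) hd1 with x | x
  · rw [hx] at hs
    exact absurd hs Sum.inl_ne_inr
  · have hpt : g • (Sum.inr d.pt : (G ⧸ (⊤ : Subgroup G)) ⊕ (G ⧸ (⊤ : Subgroup G))) =
        Sum.inr d.pt := congrArg Sum.inr (Subsingleton.elim _ _)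
    rw [DepProd.sec_congr hd hpt _ hd1, hx] at hg
    have hgx : x = g • x := Sum.inr_injective hg
    induction x using QuotientGroup.induction_on with
    | H x =>
    have h2 := QuotientGroup.eq.1 hgx
    rw [Subgroup.mem_bot, inv_mul_eq_one] at h2
    have h3 : x = g * x := h2
    exact right_eq_mul.1 h3

/-- The ideal `τ` of `T(G/G)`: the image of the transfer `T(G/e) → T(G/G)`. -/
def trIdeal : Ideal T.Top where
  carrier := Set.range (T.tr (quot (bot_le : (⊥ : Subgroup G) ≤ ⊤)))
  add_mem' := by
    rintro _ _ ⟨a, rfl⟩ ⟨b, rfl⟩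
    exact ⟨a + b, T.tr_add _ a b⟩
  zero_mem' := by
    refine ⟨0, ?_⟩
    have := T.tr_add (quot (bot_le : (⊥ : Subgroup G) ≤ ⊤)) 0 0
    rwa [add_zero, left_eq_add] at this
  smul_mem' := by
    rintro b _ ⟨a, rfl⟩
    exact T.mul_tr_mem_range b a

/-- The geometric fixed points `Φ^G T = T(G/G)/τ`, for `G` of prime order. -/
abbrev GeomFixed : Type u := T.Top ⧸ T.trIdeal

theorem mk_tr_of_free {F : Type} [Finite F] [MulAction G F]
    (hF : ∀ (g : G) (x : F), g • x = x → g = 1) (f : F →[G] G ⧸ (⊤ : Subgroup G)) (a : T.obj F) :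
    Ideal.Quotient.mk T.trIdeal (T.tr f a) = 0 :=
  Ideal.Quotient.eq_zero_iff_mem.2 (T.tr_mem_range_of_free hF f a)

/-- A constant section of the fold map over the fibres of `f`. -/
def constSec {X Y : Type} [MulAction G X] [MulAction G Y] (f : X →[G] Y) (i : X →[G] X ⊕ X)
    (hi : ∀ x, fold (G := G) X (i x) = x) : Y →[G] DepProd (fold X) f where
  toFun y := ⟨y, fun x _ => i x, fun x _ => hi x⟩
  map_smul' g y := DepProd.ext' rfl fun x h1 h2 => by
    change i x = g • i (g⁻¹ • x)
    rw [← map_smul, smul_inv_smul]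

theorem mk_nm_add (hG : (Nat.card G).Prime) (a b : T.Bot) :
    Ideal.Quotient.mk T.trIdeal (T.nm (quot bot_le) (a + b)) =
      Ideal.Quotient.mk T.trIdeal (T.nm (quot bot_le) a) +
      Ideal.Quotient.mk T.trIdeal (T.nm (quot bot_le) b) := by
  set q : G ⧸ (⊥ : Subgroup G) →[G] G ⧸ (⊤ : Subgroup G) := quot bot_le with hq
  have hq1 : ∀ x y, q x = y := fun x y => Subsingleton.elim _ _
  obtain ⟨z, rfl, rfl⟩ := T.exists_pair a b
  rw [← T.tr_fold, T.nm_tr]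
  set w := T.nm (DepProd.totalSnd (fold (G ⧸ (⊥ : Subgroup G))) q)
    (T.res (DepProd.eval (fold (G ⧸ (⊥ : Subgroup G))) q) z) with hw
  have key : ∀ (i : G ⧸ (⊥ : Subgroup G) →[G] (G ⧸ (⊥ : Subgroup G)) ⊕ (G ⧸ (⊥ : Subgroup G)))
      (hi : ∀ x, fold (G := G) _ (i x) = x), T.res (constSec q i hi) w = T.nm q (T.res i z) := by
    intro i hi
    let p : G ⧸ (⊥ : Subgroup G) →[G] DepProd.Total (fold (G ⧸ (⊥ : Subgroup G))) q :=
      { toFun := fun x => ⟨(x, constSec q i hi (q x)), rfl⟩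
        map_smul' := fun g x => Subtype.ext (Prod.ext rfl (by
          change constSec q i hi (q (g • x)) = g • constSec q i hi (q x)
          rw [map_smul, map_smul])) }
    have hp : IsPullbackSq p q (DepProd.totalSnd _ q) (constSec q i hi) := by
      refine ⟨fun _ => rfl, ?_⟩
      rintro ⟨⟨x, s⟩, hs⟩ y h
      have hs' : s = constSec q i hi y := h
      refine ⟨x, ⟨Subtype.ext (Prod.ext rfl ?_), hq1 _ _⟩, fun x' hx' => ?_⟩
      · change constSec q i hi (q x) = s
        rw [hs', hq1 x y]
      · exact congrArg (fun e => e.1.1) hx'.1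
    rw [hw, T.res_nm _ _ _ _ hp, ← T.res_comp]
    rfl
  let d₀ := constSec q (inl _ _) fun _ => rfl
  let d₁ := constSec q (inr _ _) fun _ => rfl
  let F : Type := {d : DepProd (fold (G ⧸ (⊥ : Subgroup G))) q // d ∉ MulAction.fixedPoints G _}
  let _ : MulAction G F :=
    { smul := fun g d => ⟨g • d.1, fun h => d.2 (by
        have : d.1 = g • d.1 := by
          have := h g⁻¹
          rwa [inv_smul_smul] at this
        rwa [this])⟩
      one_smul := fun d => Subtype.ext (one_smul G d.1)
      mul_smul := fun g h d => Subtype.ext (mul_smul g h d.1) }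
  have : Finite F := Subtype.finite
  have hF : ∀ (g : G) (x : F), g • x = x → g = 1 := fun g x h =>
    eq_one_of_smul_eq hG x.2 (congrArg Subtype.val h)
  let ι : F →[G] DepProd (fold (G ⧸ (⊥ : Subgroup G))) q :=
    { toFun := Subtype.val, map_smul' := fun _ _ => rfl }
  have hfix : ∀ (i : G ⧸ (⊥ : Subgroup G) →[G] _) (hi : ∀ x, fold (G := G) _ (i x) = x) y,
      constSec q i hi y ∈ MulAction.fixedPoints G _ := by
    intro i hi y g
    rw [← map_smul]
    exact congrArg _ (Subsingleton.elim _ _)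
  let e : G ⧸ (⊥ : Subgroup G) := ((1 : G) : G ⧸ (⊥ : Subgroup G))
  have hbij : Function.Bijective (desc (desc d₀ d₁) ι) := by
    constructor
    · have hne : ∀ y y', d₀ y ≠ d₁ y' := by
        intro y y' h
        exact Sum.inl_ne_inr (DepProd.sec_congr h (rfl : e = e) (hq1 _ _) (hq1 _ _))
      rintro ((y | y) | y) ((y' | y') | y') h
      · rw [Subsingleton.elim y y']
      · exact absurd h (hne _ _)
      · exact absurd (by
          have h' : d₀ y = y'.1 := h
          rw [← h']
          exact hfix _ _ _) y'.2
      · exact absurd h.symm (hne _ _)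
      · rw [Subsingleton.elim y y']
      · exact absurd (by
          have h' : d₁ y = y'.1 := h
          rw [← h']
          exact hfix _ _ _) y'.2
      · exact absurd (by
          have h' : y.1 = d₀ y' := h
          rw [h']
          exact hfix _ _ _) y.2
      · exact absurd (by
          have h' : y.1 = d₁ y' := h
          rw [h']
          exact hfix _ _ _) y.2
      · exact congrArg Sum.inr (Subtype.ext h)
    · intro d
      by_cases hd : d ∈ MulAction.fixedPoints G _
      · have hsec : ∀ g : G, d.sec (g • e) (hq1 _ _) = g • d.sec e (hq1 _ _) := by
          intro g
          rw [← DepProd.smul_sec g d e (hq1 _ _) (hq1 _ _)]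
          exact DepProd.sec_congr (hd g).symm rfl _ _
        have hx : ∀ x : G ⧸ (⊥ : Subgroup G), ∃ g : G, g • e = x := by
          intro x
          induction x using QuotientGroup.induction_on with
          | H x => exact ⟨x, congrArg QuotientGroup.mk (mul_one x)⟩
        have hspec := d.sec_spec e (hq1 _ _)
        rcases hcase : d.sec e (hq1 _ _) with u | u
        · rw [hcase] at hspec
          obtain rfl : u = e := hspec
          refine ⟨Sum.inl (Sum.inl d.pt), DepProd.ext' rfl fun x h1 h2 => ?_⟩
          obtain ⟨g, rfl⟩ := hx x
          rw [hsec, hcase]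
          rfl
        · rw [hcase] at hspec
          obtain rfl : u = e := hspec
          refine ⟨Sum.inl (Sum.inr d.pt), DepProd.ext' rfl fun x h1 h2 => ?_⟩
          obtain ⟨g, rfl⟩ := hx x
          rw [hsec, hcase]
          rfl
      · exact ⟨Sum.inr ⟨d, hd⟩, rfl⟩
  have hid : ∀ (f : G ⧸ (⊤ : Subgroup G) →[G] G ⧸ (⊤ : Subgroup G)) (c : T.Top),
      T.tr f c = c := by
    intro f c
    have : f = MulActionHom.id G := by
      ext x
      exact Subsingleton.elim _ _
    rw [this, T.tr_id]
  rw [← T.tr_res_of_bijective _ hbij w, ← T.tr_comp, T.tr_sum, T.tr_sum, map_add, map_add,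
    T.mk_tr_of_free hF, add_zero, hid, hid, ← T.res_comp, ← T.res_comp, ← T.res_comp, ← T.res_comp,
    ← key _ fun _ => rfl, ← key _ fun _ => rfl]
  rfl

/-- The norm `T(G/e) → Φ^G T`, `a ↦ nm(a) + τ`, which is a ring homomorphism. -/
def nmGeom (hG : (Nat.card G).Prime) : T.Bot →+* T.GeomFixed where
  toFun a := Ideal.Quotient.mk T.trIdeal (T.nm (quot bot_le) a)
  map_one' := by rw [T.nm_one, map_one]
  map_mul' a b := by rw [T.nm_mul, map_mul]
  map_zero' := by
    have := T.mk_nm_add hG 0 0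
    rwa [add_zero, left_eq_add] at this
  map_add' := T.mk_nm_add hG

theorem nmGeom_smul (hG : (Nat.card G).Prime) (g : G) (a : T.Bot) :
    T.nmGeom hG (g • a) = T.nmGeom hG a := by
  have hb : Function.Bijective (rightMul g) := by
    refine Function.bijective_iff_has_inverse.2 ⟨rightMul g⁻¹, fun x => ?_, fun x => ?_⟩
    · change (rightMul g⁻¹).comp (rightMul g) x = x
      rw [← rightMul_mul, mul_inv_cancel, rightMul_one]
      rfl
    · change (rightMul g).comp (rightMul g⁻¹) x = x
      rw [← rightMul_mul, inv_mul_cancel, rightMul_one]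
      rfl
  have hc : (quot bot_le : G ⧸ (⊥ : Subgroup G) →[G] G ⧸ (⊤ : Subgroup G)) =
      (quot bot_le).comp (rightMul g) := by
    ext x
    exact Subsingleton.elim _ _
  change Ideal.Quotient.mk T.trIdeal (T.nm (quot bot_le) (T.res (rightMul g) a)) =
    Ideal.Quotient.mk T.trIdeal (T.nm (quot bot_le) a)
  conv_lhs => rw [hc, T.nm_comp, T.nm_res_of_bijective _ hb]

end TambaraFunctor

/-! ### The ghost -/

namespace Ghost

open GSet MulAction

/-- The map induced on orbits. -/
def orbMap {G : Type} [Group G] {X Y : Type} [MulAction G X] [MulAction G Y] (f : X →[G] Y) :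
    orbitRel.Quotient G X → orbitRel.Quotient G Y :=
  Quotient.map' f fun a b h => by
    obtain ⟨g, rfl⟩ := h
    exact ⟨g, (map_smul f g b).symm⟩

section FiniteSums

variable {ι : Type*} [Finite ι] {M : Type*} [CommMonoid M]


@[to_additive]
theorem finprod_fiber {κ μ : Type*} [Finite κ] [Finite μ] (f : κ → μ) (p : μ → Prop)
    (r : κ → μ → Prop) (hr : ∀ k l, r k l ↔ f k = l) (c : κ → M) :
    (∏ᶠ k : {k // p (f k)}, c k) = ∏ᶠ l : {l // p l}, ∏ᶠ k : {k // r k l.1}, c k := by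
  classical
  cases nonempty_fintype κ
  cases nonempty_fintype μ
  simp only [finprod_eq_prod_of_fintype]
  rw [← Fintype.prod_sigma' (fun (l : {l // p l}) (k : {k // r k l.1}) => c k)]
  refine Fintype.prod_bijective
    (fun k => (⟨⟨f k.1, k.2⟩, ⟨k.1, (hr _ _).2 rfl⟩⟩ : Σ l : {l // p l}, {k // r k l.1})) ?_ _ _
    fun _ => rfl
  constructor
  · rintro ⟨k, hk⟩ ⟨k', hk'⟩ h
    have := congrArg (fun s => s.2.1) h
    exact Subtype.ext this
  · rintro ⟨⟨l, hl⟩, ⟨k, hk⟩⟩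
    obtain rfl : f k = l := (hr _ _).1 hk
    exact ⟨⟨k, hl⟩, rfl⟩

theorem finprod_finsum {S : Type*} [CommSemiring S] {κ : ι → Type*} [∀ i, Finite (κ i)]
    (c : ∀ i, κ i → S) :
    (∏ᶠ i, ∑ᶠ k, c i k) = ∑ᶠ s : ∀ i, κ i, ∏ᶠ i, c i (s i) := by
  classical
  cases nonempty_fintype ι
  have := fun i => Fintype.ofFinite (κ i)
  simp only [finprod_eq_prod_of_fintype, finsum_eq_sum_of_fintype]
  exact Finset.prod_univ_sum _ _ |>.trans (by rw [Fintype.piFinset_univ])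

theorem map_finprod' {S S' : Type*} [CommSemiring S] [CommSemiring S'] (n : S →+* S')
    (c : ι → S) : n (∏ᶠ i, c i) = ∏ᶠ i, n (c i) := by
  cases nonempty_fintype ι
  simp only [finprod_eq_prod_of_fintype, map_prod]

theorem map_finsum' {S S' : Type*} [CommSemiring S] [CommSemiring S'] (n : S →+* S')
    (c : ι → S) : n (∑ᶠ i, c i) = ∑ᶠ i, n (c i) := by
  cases nonempty_fintype ι
  simp only [finsum_eq_sum_of_fintype, map_sum]

end FiniteSums

variable {G : Type} [Group G]

/-- The ring `Map_G(X, R)` of equivariant functions. -/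
def equivariantFun (G : Type) [Group G] (X : Type) [MulAction G X] (R : Type u) [CommRing R]
    [MulSemiringAction G R] : Subring (X → R) where
  carrier := {a | ∀ (g : G) x, a (g • x) = g • a x}
  mul_mem' ha hb g x := by simp [ha g x, hb g x]
  one_mem' g x := by simp
  add_mem' ha hb g x := by simp [ha g x, hb g x]
  zero_mem' g x := by simp
  neg_mem' ha g x := by simp [ha g x]

variable {R Φ : Type u} [CommRing R] [MulSemiringAction G R] [CommRing Φ]

variable (G R Φ) in
/-- The ring `Map_G(X, R) × Map(X^G, Φ)`. For `X = G/e` it is `R`, for `X = G/G` it is `R^G × Φ`. -/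
abbrev Obj (X : Type) [MulAction G X] : Type u :=
  equivariantFun G X R × (fixedPoints G X → Φ)

variable {P A X Y Z : Type} [MulAction G P] [MulAction G A] [MulAction G X] [MulAction G Y]
  [MulAction G Z]

theorem map_mem_fixedPoints (f : X →[G] Y) {x : X} (hx : x ∈ fixedPoints G X) :
    f x ∈ fixedPoints G Y := fun g => by rw [← map_smul, hx g]

theorem smul_mem_fixedPoints (g : G) {x : X} : g • x ∈ fixedPoints G X ↔ x ∈ fixedPoints G X := by
  constructor
  · intro h
    have := h g⁻¹
    rw [inv_smul_smul] at this
    rwa [this]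
  · intro h
    rwa [h g]

/-- Restriction is composition with `f`. -/
def res (f : X →[G] Y) (v : Obj G R Φ Y) : Obj G R Φ X :=
  (⟨fun x => v.1.1 (f x), fun g x => by
    change v.1.1 (f (g • x)) = _
    rw [map_smul]
    exact v.1.2 g (f x)⟩,
    fun x => v.2 ⟨f x, map_mem_fixedPoints f x.2⟩)

/-- Transfer: sums over fibres in the first component, sums over the fixed points of fibres in the
second. -/
noncomputable def tr [Finite X] (f : X →[G] Y) (v : Obj G R Φ X) : Obj G R Φ Y :=
  (⟨fun y => ∑ᶠ x : {x : X // f x = y}, v.1.1 x, fun g y => by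
      have : (g • ∑ᶠ x : {x : X // f x = y}, v.1.1 x) =
          MulSemiringAction.toRingHom G R g (∑ᶠ x : {x : X // f x = y}, v.1.1 x) := rfl
      rw [this, map_finsum']
      refine (finsum_eq_of_bijective
        (fun x : {x : X // f x = y} => (⟨g • x.1, by rw [map_smul, x.2]⟩ : {x // f x = g • y}))
        ?_ fun x => (v.1.2 g x.1).symm).symm
      constructor
      · rintro ⟨x, hx⟩ ⟨x', hx'⟩ h
        exact Subtype.ext (smul_left_cancel g (congrArg Subtype.val h))
      · rintro ⟨x, hx⟩
        exact ⟨⟨g⁻¹ • x, by rw [map_smul, hx, inv_smul_smul]⟩,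
          Subtype.ext (smul_inv_smul g x)⟩⟩,
    fun y => ∑ᶠ x : {x : fixedPoints G X // f x.1 = y.1}, v.2 x)

open Classical in
/-- The function `X → Φ` that is given by the second component on fixed points and by `n` of the
first component on free orbits. -/
noncomputable def extFun (n : R →+* Φ) (v : Obj G R Φ X) (x : X) : Φ :=
  if h : x ∈ fixedPoints G X then v.2 ⟨x, h⟩ else n (v.1.1 x)

/-- `extFun` as a function of the orbit. -/
noncomputable def orbFun (n : R →+* Φ) (hn : ∀ (g : G) r, n (g • r) = n r) (v : Obj G R Φ X) :
    orbitRel.Quotient G X → Φ :=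
  Quotient.lift (extFun n v) fun a b h => by
    obtain ⟨g, rfl⟩ := h
    change extFun n v (g • b) = extFun n v b
    by_cases hb : b ∈ fixedPoints G X
    · rw [hb g]
    · rw [extFun, extFun, dif_neg hb, dif_neg (mt (smul_mem_fixedPoints g).1 hb), v.1.2 g b, hn]

/-- Norm: products over fibres in the first component; in the second component, at a fixed point
`y`, the product over the orbits in the fibre of `y`, where a fixed point contributes its value in
`Φ` and a free orbit contributes `n` of the value in `R` of any of its points. -/
noncomputable def nm (n : R →+* Φ) (hn : ∀ (g : G) r, n (g • r) = n r) [Finite X] (f : X →[G] Y)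
    (v : Obj G R Φ X) : Obj G R Φ Y :=
  (⟨fun y => ∏ᶠ x : {x : X // f x = y}, v.1.1 x, fun g y => by
      have : (g • ∏ᶠ x : {x : X // f x = y}, v.1.1 x) =
          MulSemiringAction.toRingHom G R g (∏ᶠ x : {x : X // f x = y}, v.1.1 x) := rfl
      rw [this, map_finprod']
      refine (finprod_eq_of_bijective
        (fun x : {x : X // f x = y} => (⟨g • x.1, by rw [map_smul, x.2]⟩ : {x // f x = g • y}))
        ?_ fun x => (v.1.2 g x.1).symm).symm
      constructor
      · rintro ⟨x, hx⟩ ⟨x', hx'⟩ h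
        exact Subtype.ext (smul_left_cancel g (congrArg Subtype.val h))
      · rintro ⟨x, hx⟩
        exact ⟨⟨g⁻¹ • x, by rw [map_smul, hx, inv_smul_smul]⟩,
          Subtype.ext (smul_inv_smul g x)⟩⟩,
    fun y => ∏ᶠ o : {o : orbitRel.Quotient G X // orbMap f o = Quotient.mk _ y.1},
      orbFun n hn v o)

theorem ext {R Φ : Type u} [CommRing R] [MulSemiringAction G R] {X : Type}
    [MulAction G X] {v w : Obj G R Φ X} (h₁ : ∀ x, v.1.1 x = w.1.1 x) (h₂ : ∀ x, v.2 x = w.2 x) : v = w :=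
  Prod.ext (Subtype.ext (funext h₁)) (funext h₂)

variable (n : R →+* Φ) (hn : ∀ (g : G) r, n (g • r) = n r)

theorem orbFun_mk (v : Obj G R Φ X) (x : X) : orbFun n hn v (Quotient.mk _ x) = extFun n v x := rfl

theorem extFun_of_mem (v : Obj G R Φ X) {x : X} (h : x ∈ fixedPoints G X) :
    extFun n v x = v.2 ⟨x, h⟩ := dif_pos h

theorem extFun_of_not_mem (v : Obj G R Φ X) {x : X} (h : x ∉ fixedPoints G X) :
    extFun n v x = n (v.1.1 x) := dif_neg h

theorem extFun_res (f : X →[G] Y) (v : Obj G R Φ Y) {x : X}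
    (h : f x ∈ fixedPoints G Y → x ∈ fixedPoints G X) :
    extFun n (res f v) x = extFun n v (f x) := by
  by_cases hx : x ∈ fixedPoints G X
  · rw [extFun_of_mem n _ hx, extFun_of_mem n _ (map_mem_fixedPoints f hx)]
    rfl
  · rw [extFun_of_not_mem n _ hx, extFun_of_not_mem n _ (mt h hx)]
    rfl

theorem eq_of_mk_eq {y y' : Y} (hy : y ∈ fixedPoints G Y)
    (h : (Quotient.mk _ y' : orbitRel.Quotient G Y) = Quotient.mk _ y) : y' = y := by
  obtain ⟨g, hg⟩ := Quotient.exact h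
  exact hg.symm.trans (hy g)

theorem orbFun_nm (hG : (Nat.card G).Prime) [Finite X] (f : X →[G] Y) (v : Obj G R Φ X)
    (o : orbitRel.Quotient G Y) :
    orbFun n hn (nm n hn f v) o =
      ∏ᶠ o' : {o' : orbitRel.Quotient G X // orbMap f o' = o}, orbFun n hn v o' := by
  induction o using Quotient.inductionOn with
  | h y =>
  rw [orbFun_mk]
  by_cases hy : y ∈ fixedPoints G Y
  · rw [extFun_of_mem n _ hy]
    rfl
  · rw [extFun_of_not_mem n _ hy]
    change n (∏ᶠ x : {x : X // f x = y}, v.1.1 x) = _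
    rw [map_finprod']
    refine finprod_eq_of_bijective (fun x : {x : X // f x = y} =>
      (⟨Quotient.mk _ x.1, congrArg (Quotient.mk _) x.2⟩ :
        {o' : orbitRel.Quotient G X // orbMap f o' = Quotient.mk _ y})) ?_ ?_
    · constructor
      · rintro ⟨x, hx⟩ ⟨x', hx'⟩ h
        obtain ⟨g, hg⟩ := Quotient.exact (congrArg Subtype.val h)
        have hg' : g • x' = x := hg
        have : g • y = y := by
          rw [← hx'] at hx ⊢
          rw [← map_smul, hg', hx]
        rw [eq_one_of_smul_eq hG hy this, one_smul] at hg'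
        exact Subtype.ext hg'.symm
      · rintro ⟨o', ho'⟩
        induction o' using Quotient.inductionOn with
        | h x =>
        obtain ⟨g, hg⟩ := Quotient.exact ho'.symm
        refine ⟨⟨g • x, by rw [map_smul]; exact hg⟩, Subtype.ext (Quotient.sound ⟨g, rfl⟩)⟩
    · rintro ⟨x, hx⟩
      rw [orbFun_mk, extFun_of_not_mem]
      intro h
      apply hy
      rw [← hx]
      exact map_mem_fixedPoints f h

theorem res_tr [Finite X] [Finite P] (p₁ : P →[G] X) (p₂ : P →[G] Y) (f : X →[G] Z)
    (g : Y →[G] Z) (h : IsPullbackSq p₁ p₂ f g) (v : Obj G R Φ X) :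
    res g (tr f v) = tr p₂ (res p₁ v) := by
  have inj : ∀ a b, p₁ a = p₁ b → p₂ a = p₂ b → a = b := fun a b h1 h2 =>
    (h.exists_unique _ _ (h.comm b)).unique ⟨h1, h2⟩ ⟨rfl, rfl⟩
  refine ext (fun y => ?_) fun y => ?_
  · refine (finsum_eq_of_bijective (fun a : {a : P // p₂ a = y} =>
      (⟨p₁ a.1, by rw [h.comm, a.2]⟩ : {x : X // f x = g y})) ⟨?_, ?_⟩ fun _ => rfl).symm
    · rintro ⟨a, ha⟩ ⟨b, hb⟩ hab
      exact Subtype.ext (inj _ _ (congrArg Subtype.val hab) (ha.trans hb.symm))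
    · rintro ⟨x, hx⟩
      obtain ⟨a, ⟨h1, h2⟩, -⟩ := h.exists_unique _ _ hx
      exact ⟨⟨a, h2⟩, Subtype.ext h1⟩
  · refine (finsum_eq_of_bijective (fun a : {a : fixedPoints G P // p₂ a.1 = y.1} =>
      (⟨⟨p₁ a.1, map_mem_fixedPoints p₁ a.1.2⟩, by
        change f (p₁ a.1.1) = g y.1
        rw [h.comm, a.2]⟩ :
        {x : fixedPoints G X // f x.1 = g y.1})) ⟨?_, ?_⟩ fun _ => rfl).symm
    · rintro ⟨⟨a, ha'⟩, ha⟩ ⟨⟨b, hb'⟩, hb⟩ hab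
      exact Subtype.ext (Subtype.ext (inj _ _ (congrArg (fun z => z.1.1) hab) (ha.trans hb.symm)))
    · rintro ⟨⟨x, hx'⟩, hx⟩
      obtain ⟨a, ⟨h1, h2⟩, -⟩ := h.exists_unique _ _ hx
      refine ⟨⟨⟨a, fun m => inj _ _ ?_ ?_⟩, h2⟩, Subtype.ext (Subtype.ext h1)⟩
      · rw [map_smul, h1, hx' m]
      · rw [map_smul, h2, y.2 m]

theorem res_nm [Finite X] [Finite P] (p₁ : P →[G] X) (p₂ : P →[G] Y) (f : X →[G] Z)
    (g : Y →[G] Z) (h : IsPullbackSq p₁ p₂ f g) (v : Obj G R Φ X) :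
    res g (nm n hn f v) = nm n hn p₂ (res p₁ v) := by
  have inj : ∀ a b, p₁ a = p₁ b → p₂ a = p₂ b → a = b := fun a b h1 h2 =>
    (h.exists_unique _ _ (h.comm b)).unique ⟨h1, h2⟩ ⟨rfl, rfl⟩
  refine ext (fun y => ?_) fun y => ?_
  · refine (finprod_eq_of_bijective (fun a : {a : P // p₂ a = y} =>
      (⟨p₁ a.1, by rw [h.comm, a.2]⟩ : {x : X // f x = g y})) ⟨?_, ?_⟩ fun _ => rfl).symm
    · rintro ⟨a, ha⟩ ⟨b, hb⟩ hab
      exact Subtype.ext (inj _ _ (congrArg Subtype.val hab) (ha.trans hb.symm))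
    · rintro ⟨x, hx⟩
      obtain ⟨a, ⟨h1, h2⟩, -⟩ := h.exists_unique _ _ hx
      exact ⟨⟨a, h2⟩, Subtype.ext h1⟩
  · refine (finprod_eq_of_bijective
      (fun o : {o : orbitRel.Quotient G P // orbMap p₂ o = Quotient.mk _ y.1} =>
      (⟨orbMap p₁ o.1, ?_⟩ :
        {o : orbitRel.Quotient G X // orbMap f o = Quotient.mk _ (g y.1)})) ⟨?_, ?_⟩ ?_).symm
    · obtain ⟨o, ho⟩ := o
      induction o using Quotient.inductionOn with
      | h a =>
      have := eq_of_mk_eq y.2 ho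
      change Quotient.mk _ (f (p₁ a)) = Quotient.mk _ (g y.1)
      rw [h.comm, this]
    · rintro ⟨o, ho⟩ ⟨o', ho'⟩ hoo
      induction o using Quotient.inductionOn with
      | h a =>
      induction o' using Quotient.inductionOn with
      | h b =>
      obtain ⟨m, hm⟩ := Quotient.exact (congrArg Subtype.val hoo)
      have hm' : m • p₁ b = p₁ a := hm
      refine Subtype.ext (Quotient.sound ⟨m, inj _ _ ?_ ?_⟩)
      · change p₁ (m • b) = p₁ a
        rw [map_smul, hm']
      · change p₂ (m • b) = p₂ a
        rw [map_smul, eq_of_mk_eq y.2 ho, eq_of_mk_eq y.2 ho', y.2 m]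
    · rintro ⟨o, ho⟩
      induction o using Quotient.inductionOn with
      | h x =>
      have := eq_of_mk_eq (map_mem_fixedPoints g y.2) ho
      obtain ⟨a, ⟨h1, h2⟩, -⟩ := h.exists_unique _ _ this
      exact ⟨⟨Quotient.mk _ a, congrArg (Quotient.mk _) h2⟩,
        Subtype.ext (congrArg (Quotient.mk _) h1)⟩
    · rintro ⟨o, ho⟩
      induction o using Quotient.inductionOn with
      | h a =>
      have hy := eq_of_mk_eq y.2 ho
      refine extFun_res n p₁ v fun hx m => inj _ _ ?_ ?_
      · rw [map_smul, hx m]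
      · have : p₂ a = y.1 := hy
        rw [map_smul, this, y.2 m]

theorem extFun_tr [Finite A] [Finite X] (q : A →[G] X) (v : Obj G R Φ A) (x : X) :
    extFun n (tr q v) x =
      ∑ᶠ a : {a : A // q a = x ∧ (x ∈ fixedPoints G X → a ∈ fixedPoints G A)}, extFun n v a := by
  by_cases hx : x ∈ fixedPoints G X
  · rw [extFun_of_mem n _ hx]
    refine (finsum_eq_of_bijective
      (fun a : {a : A // q a = x ∧ (x ∈ fixedPoints G X → a ∈ fixedPoints G A)} =>
        (⟨⟨a.1, a.2.2 hx⟩, a.2.1⟩ : {a : fixedPoints G A // q a.1 = x})) ⟨?_, ?_⟩ ?_).symm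
    · intro a b h
      exact Subtype.ext (congrArg (fun z : {a : fixedPoints G A // q a.1 = x} => z.1.1) h)
    · rintro ⟨⟨a, ha⟩, h⟩
      exact ⟨⟨a, h, fun _ => ha⟩, rfl⟩
    · intro a
      exact extFun_of_mem n v (a.2.2 hx)
  · rw [extFun_of_not_mem n _ hx]
    change n (∑ᶠ a : {a : A // q a = x}, v.1.1 a) = _
    rw [map_finsum']
    refine (finsum_eq_of_bijective
      (fun a : {a : A // q a = x ∧ (x ∈ fixedPoints G X → a ∈ fixedPoints G A)} =>
        (⟨a.1, a.2.1⟩ : {a : A // q a = x})) ⟨?_, ?_⟩ ?_).symm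
    · intro a b h
      exact Subtype.ext (congrArg (fun z : {a : A // q a = x} => z.1) h)
    · rintro ⟨a, h⟩
      exact ⟨⟨a, h, fun h' => absurd h' hx⟩, rfl⟩
    · rintro ⟨a, rfl, -⟩
      exact extFun_of_not_mem n v (mt (map_mem_fixedPoints q) hx)

theorem mk_out (o : orbitRel.Quotient G X) : Quotient.mk _ o.out = o := Quotient.out_eq o

/-- Equivariant sections over an invariant fibre are determined by their values on representatives
of the orbits, and these values are subject to one condition: a fixed point goes to a fixed point. -/
theorem bijective_sections (hG : (Nat.card G).Prime) (q : A →[G] X) (f : X →[G] Y)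
    (y : fixedPoints G Y) :
    Function.Bijective fun (s : {s : fixedPoints G (DepProd q f) // s.1.pt = y.1})
      (o : {o : orbitRel.Quotient G X // orbMap f o = Quotient.mk _ y.1}) =>
      (⟨s.1.1.sec o.1.out (by
          rw [s.2]
          refine eq_of_mk_eq y.2 ?_
          change orbMap f (Quotient.mk _ o.1.out) = _
          rw [mk_out, o.2]),
        s.1.1.sec_spec _ _, fun h m => by
          rw [← DepProd.smul_sec m s.1.1 o.1.out _ (by
            rw [s.1.2 m, h m, s.2]
            refine eq_of_mk_eq y.2 ?_
            change orbMap f (Quotient.mk _ o.1.out) = _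
            rw [mk_out, o.2])]
          exact DepProd.sec_congr (s.1.2 m) (h m) _ _⟩ :
        {a : A // q a = o.1.out ∧ (o.1.out ∈ fixedPoints G X → a ∈ fixedPoints G A)}) := by
  have hc : ∀ x : X, ∃ g : G, g • (Quotient.mk (orbitRel G X) x).out = x := fun x =>
    orbitRel_apply.1 ((orbitRel G X).symm (Quotient.mk_out x))
  constructor
  · rintro ⟨⟨s, hs⟩, hsy⟩ ⟨⟨t, ht⟩, hty⟩ h
    refine Subtype.ext (Subtype.ext (DepProd.ext' (hsy.trans hty.symm) fun x h1 h2 => ?_))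
    obtain ⟨g, hg⟩ := hc x
    have hfx : f x = y.1 := h1.trans hsy
    have ho : orbMap f (Quotient.mk _ x) = Quotient.mk _ y.1 := congrArg (Quotient.mk _) hfx
    have hout : f (Quotient.mk (orbitRel G X) x).out = y.1 := by
      refine eq_of_mk_eq y.2 ?_
      change orbMap f (Quotient.mk _ (Quotient.mk (orbitRel G X) x).out) = _
      rw [mk_out, ho]
    have key : s.sec _ (hout.trans hsy.symm) = t.sec _ (hout.trans hty.symm) :=
      congrArg Subtype.val (congrFun h ⟨_, ho⟩)
    have e1 : s.sec x h1 = g • s.sec _ (hout.trans hsy.symm) := by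
      rw [← DepProd.smul_sec g s _ _ (by rw [hg, hs g, h1])]
      exact DepProd.sec_congr (hs g).symm hg.symm _ _
    have e2 : t.sec x h2 = g • t.sec _ (hout.trans hty.symm) := by
      rw [← DepProd.smul_sec g t _ _ (by rw [hg, ht g, h2])]
      exact DepProd.sec_congr (ht g).symm hg.symm _ _
    rw [e1, e2, key]
  · intro t
    choose c hc using hc
    have ho : ∀ x, f x = y.1 → orbMap f (Quotient.mk _ x) = Quotient.mk _ y.1 := fun x h =>
      congrArg (Quotient.mk _) h
    have ht : ∀ (o : {o : orbitRel.Quotient G X // orbMap f o = Quotient.mk _ y.1}) (g g' : G),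
        g • o.1.out = g' • o.1.out → g • (t o).1 = g' • (t o).1 := by
      intro o g g' h
      by_cases hx : o.1.out ∈ fixedPoints G X
      · rw [(t o).2.2 hx g, (t o).2.2 hx g']
      · have h' : (g'⁻¹ * g) • o.1.out = o.1.out := by
          rw [mul_smul, h, inv_smul_smul]
        rw [inv_mul_eq_one.1 (eq_one_of_smul_eq hG hx h')]
    have ht' : ∀ (o o' : {o : orbitRel.Quotient G X // orbMap f o = Quotient.mk _ y.1}),
        o.1 = o'.1 → (t o).1 = (t o').1 := by
      intro o o' h
      obtain rfl : o = o' := Subtype.ext h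
      rfl
    let s : DepProd q f := ⟨y.1, fun x h => c x • (t ⟨_, ho x h⟩).1, fun x h => by
      rw [map_smul, (t _).2.1, hc]⟩
    have hs : s ∈ fixedPoints G (DepProd q f) := by
      intro m
      refine DepProd.ext' (y.2 m) fun x h1 h2 => ?_
      have h2' : f x = y.1 := h2
      have h3 : f (m⁻¹ • x) = y.1 := by rw [map_smul, h2', y.2 m⁻¹]
      change m • c (m⁻¹ • x) • (t ⟨_, ho _ h3⟩).1 = c x • (t ⟨_, ho x h2⟩).1
      have e : (Quotient.mk (orbitRel G X) (m⁻¹ • x)) = Quotient.mk _ x :=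
        Quotient.sound ⟨m⁻¹, rfl⟩
      rw [ht' ⟨_, ho _ h3⟩ ⟨_, ho x h2⟩ e, smul_smul]
      refine ht _ _ _ ?_
      have := hc (m⁻¹ • x)
      rw [e] at this
      rw [mul_smul, hc]
      change m • c (m⁻¹ • x) • (Quotient.mk (orbitRel G X) x).out = x
      rw [this, smul_inv_smul]
    refine ⟨⟨⟨s, hs⟩, rfl⟩, ?_⟩
    funext o
    refine Subtype.ext ?_
    have hout : f o.1.out = y.1 := by
      refine eq_of_mk_eq y.2 ?_
      change orbMap f (Quotient.mk _ o.1.out) = _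
      rw [mk_out, o.2]
    change c o.1.out • (t ⟨_, ho _ hout⟩).1 = (t o).1
    rw [ht' ⟨_, ho _ hout⟩ o (mk_out o.1)]
    conv_rhs => rw [← one_smul G (t o).1]
    refine ht _ _ _ ?_
    have := hc o.1.out
    rw [mk_out] at this
    rw [this, one_smul]

theorem nm_tr (hG : (Nat.card G).Prime) [Finite A] [Finite X] [Finite Y] (q : A →[G] X)
    (f : X →[G] Y) (v : Obj G R Φ A) :
    nm n hn f (tr q v) =
      tr (DepProd.proj q f) (nm n hn (DepProd.totalSnd q f) (res (DepProd.eval q f) v)) := by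
  refine ext (fun y => ?_) fun y => ?_
  · change (∏ᶠ x : {x : X // f x = y}, ∑ᶠ a : {a : A // q a = x.1}, v.1.1 a) =
      ∑ᶠ s : {s : DepProd q f // s.pt = y},
        ∏ᶠ e : {e : DepProd.Total q f // e.1.2 = s.1}, v.1.1 (DepProd.eval q f e.1)
    rw [finprod_finsum]
    refine finsum_eq_of_bijective (fun s =>
      (⟨⟨y, fun x h => (s ⟨x, h⟩).1, fun x h => (s ⟨x, h⟩).2⟩, rfl⟩ :
        {s : DepProd q f // s.pt = y})) ⟨?_, ?_⟩ ?_
    · intro s t hst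
      funext x
      exact Subtype.ext (DepProd.sec_congr (congrArg Subtype.val hst) rfl x.2 x.2)
    · rintro ⟨s, rfl⟩
      exact ⟨fun x => ⟨s.sec x.1 x.2, s.sec_spec x.1 x.2⟩, rfl⟩
    · intro s
      refine finprod_eq_of_bijective (fun x : {x : X // f x = y} =>
        ⟨⟨(x.1, ⟨y, fun x h => (s ⟨x, h⟩).1, fun x h => (s ⟨x, h⟩).2⟩), x.2⟩, rfl⟩) ⟨?_, ?_⟩
        fun _ => rfl
      · intro x x' h
        exact Subtype.ext (congrArg (fun e => e.1.1.1) h)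
      · rintro ⟨⟨⟨x, t⟩, ht⟩, h⟩
        obtain rfl : t = _ := h
        exact ⟨⟨x, ht⟩, rfl⟩
  · change (∏ᶠ o : {o : orbitRel.Quotient G X // orbMap f o = Quotient.mk _ y.1},
        orbFun n hn (tr q v) o.1) =
      ∑ᶠ s : {s : fixedPoints G (DepProd q f) // s.1.pt = y.1},
        ∏ᶠ e : {e : orbitRel.Quotient G (DepProd.Total q f) //
          orbMap (DepProd.totalSnd q f) e = Quotient.mk _ s.1.1},
          orbFun n hn (res (DepProd.eval q f) v) e.1
    have h1 : ∀ o : orbitRel.Quotient G X, orbFun n hn (tr q v) o =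
        ∑ᶠ a : {a : A // q a = o.out ∧ (o.out ∈ fixedPoints G X → a ∈ fixedPoints G A)},
          extFun n v a := by
      intro o
      rw [← extFun_tr, ← orbFun_mk n hn, mk_out]
    simp only [h1]
    rw [finprod_finsum]
    refine (finsum_eq_of_bijective _ (bijective_sections hG q f y) ?_).symm
    rintro ⟨⟨s, hs⟩, hsy⟩
    have hsy' : s.pt = y.1 := hsy
    have hout : ∀ o : {o : orbitRel.Quotient G X // orbMap f o = Quotient.mk _ y.1},
        f o.1.out = s.pt := by
      intro o
      rw [hsy']
      refine eq_of_mk_eq y.2 ?_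
      change orbMap f (Quotient.mk _ o.1.out) = _
      rw [mk_out, o.2]
    refine (finprod_eq_of_bijective
      (fun o : {o : orbitRel.Quotient G X // orbMap f o = Quotient.mk _ y.1} =>
        (⟨Quotient.mk _ ⟨(o.1.out, s), hout o⟩, rfl⟩ :
          {e : orbitRel.Quotient G (DepProd.Total q f) //
            orbMap (DepProd.totalSnd q f) e = Quotient.mk _ s})) ⟨?_, ?_⟩ ?_).symm
    · intro o o' h
      obtain ⟨g, hg⟩ := Quotient.exact (congrArg Subtype.val h)
      have hg' : g • o'.1.out = o.1.out := congrArg (fun e => e.1.1) hg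
      refine Subtype.ext ?_
      rw [← mk_out o.1, ← mk_out o'.1]
      exact Quotient.sound ⟨g, hg'⟩
    · rintro ⟨e, he⟩
      induction e using Quotient.inductionOn with
      | h e =>
      obtain ⟨⟨x, s'⟩, hx⟩ := e
      obtain rfl : s' = s := eq_of_mk_eq hs he
      refine ⟨⟨Quotient.mk _ x, congrArg (Quotient.mk _) (hx.trans hsy)⟩, Subtype.ext ?_⟩
      obtain ⟨g, hg⟩ := (orbitRel_apply.1 (Quotient.mk_out x) :
        (Quotient.mk (orbitRel G X) x).out ∈ orbit G x)
      exact Quotient.sound ⟨g, Subtype.ext (Prod.ext hg (hs g))⟩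
    · intro o
      let e : DepProd.Total q f := ⟨(o.1.out, s), hout o⟩
      refine (extFun_res n (DepProd.eval q f) v (x := e) fun ha g => ?_).symm
      refine Subtype.ext (Prod.ext ?_ (hs g))
      have := map_mem_fixedPoints q ha g
      rwa [show q (DepProd.eval q f e) = o.1.out from s.sec_spec _ _] at this

theorem tr_comp [Finite X] [Finite Y] (g : Y →[G] Z) (f : X →[G] Y) (v : Obj G R Φ X) :
    tr (g.comp f) v = tr g (tr f v) := by
  refine ext (fun z => ?_) fun z => ?_
  · exact finsum_fiber f (fun y => g y = z) (fun x y => f x = y) (fun _ _ => Iff.rfl) v.1.1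
  · exact finsum_fiber
      (fun x : fixedPoints G X => (⟨f x.1, map_mem_fixedPoints f x.2⟩ : fixedPoints G Y))
      (fun y => g y.1 = z.1) (fun x y => f x.1 = y.1) (fun _ _ => ⟨fun h => Subtype.ext h, fun h => congrArg Subtype.val h⟩) v.2

theorem nm_comp (hG : (Nat.card G).Prime) [Finite X] [Finite Y] (g : Y →[G] Z)
    (f : X →[G] Y) (v : Obj G R Φ X) :
    nm n hn (g.comp f) v = nm n hn g (nm n hn f v) := by
  refine ext (fun z => ?_) fun z => ?_
  · exact finprod_fiber f (fun y => g y = z) (fun x y => f x = y) (fun _ _ => Iff.rfl) v.1.1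
  · change (∏ᶠ o : {o : orbitRel.Quotient G X // orbMap (g.comp f) o = Quotient.mk _ z.1},
        orbFun n hn v o.1) = ∏ᶠ o : {o : orbitRel.Quotient G Y // orbMap g o = Quotient.mk _ z.1},
        orbFun n hn (nm n hn f v) o.1
    simp only [orbFun_nm n hn hG]
    rw [← finprod_fiber (orbMap f) (fun o => orbMap g o = Quotient.mk _ z.1)
      (fun o o' => orbMap f o = o') (fun _ _ => Iff.rfl) (orbFun n hn v)]
    have : orbMap (g.comp f) = fun o => orbMap g (orbMap f o) := by
      funext o
      induction o using Quotient.inductionOn with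
      | h x => rfl
    rw [this]

theorem res_desc_injective (v w : Obj G R Φ (X ⊕ Y)) (h₁ : res (inl X Y) v = res (inl X Y) w)
    (h₂ : res (inr X Y) v = res (inr X Y) w) : v = w := by
  refine ext (fun x => ?_) ?_
  · cases x with
    | inl x => exact congrFun (congrArg (fun t => t.1.1) h₁) x
    | inr x => exact congrFun (congrArg (fun t => t.1.1) h₂) x
  · rintro ⟨x | x, hx⟩
    · exact congrFun (congrArg (fun t => t.2) h₁)
        (⟨x, fun g => Sum.inl_injective (hx g)⟩ : fixedPoints G X)
    · exact congrFun (congrArg (fun t => t.2) h₂)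
        (⟨x, fun g => Sum.inr_injective (hx g)⟩ : fixedPoints G Y)

theorem bijective_res (X Y : Type) [MulAction G X] [MulAction G Y] :
    Function.Bijective fun v : Obj G R Φ (X ⊕ Y) => (res (inl X Y) v, res (inr X Y) v) := by
  constructor
  · intro v w h
    exact res_desc_injective v w (congrArg Prod.fst h) (congrArg Prod.snd h)
  · rintro ⟨v, w⟩
    refine ⟨(⟨Sum.elim v.1.1 w.1.1, ?_⟩, fun x => match x with
      | ⟨Sum.inl x, hx⟩ => v.2 ⟨x, fun g => Sum.inl_injective (hx g)⟩
      | ⟨Sum.inr x, hx⟩ => w.2 ⟨x, fun g => Sum.inr_injective (hx g)⟩), rfl⟩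
    rintro g (x | x)
    · exact v.1.2 g x
    · exact w.1.2 g x

@[to_additive]
theorem finprod_two {ι M : Type*} [CommMonoid M] (i j : ι) (hij : i ≠ j)
    (h : ∀ k, k = i ∨ k = j) (c : ι → M) : ∏ᶠ k, c k = c i * c j := by
  classical
  have : Fintype ι := ⟨{i, j}, fun k => by simpa using h k⟩
  have hu : (Finset.univ : Finset ι) = {i, j} := by
    ext k
    simpa using h k
  rw [finprod_eq_prod_of_fintype, hu, Finset.prod_pair hij]

theorem tr_fold [Finite X] (v : Obj G R Φ (X ⊕ X)) :
    tr (fold X) v = res (inl X X) v + res (inr X X) v := by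
  refine ext (fun x => ?_) fun x => ?_
  · refine finsum_two (⟨Sum.inl x, rfl⟩ : {z : X ⊕ X // fold (G := G) X z = x})
      ⟨Sum.inr x, rfl⟩ (fun h => Sum.inl_ne_inr (congrArg Subtype.val h)) ?_ _
    rintro ⟨z | z, rfl⟩
    · exact Or.inl rfl
    · exact Or.inr rfl
  · refine finsum_two (⟨⟨Sum.inl x.1, map_mem_fixedPoints (inl X X) x.2⟩, rfl⟩ :
        {z : fixedPoints G (X ⊕ X) // fold (G := G) X z.1 = x.1})
      ⟨⟨Sum.inr x.1, map_mem_fixedPoints (inr X X) x.2⟩, rfl⟩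
      (fun h => Sum.inl_ne_inr (congrArg (fun z => z.1.1) h)) ?_ _
    rintro ⟨⟨z | z, hz⟩, hzx⟩
    · exact Or.inl (Subtype.ext (Subtype.ext (congrArg Sum.inl hzx)))
    · exact Or.inr (Subtype.ext (Subtype.ext (congrArg Sum.inr hzx)))

theorem nm_fold [Finite X] (v : Obj G R Φ (X ⊕ X)) :
    nm n hn (fold X) v = res (inl X X) v * res (inr X X) v := by
  refine ext (fun x => ?_) fun x => ?_
  · refine finprod_two (⟨Sum.inl x, rfl⟩ : {z : X ⊕ X // fold (G := G) X z = x})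
      ⟨Sum.inr x, rfl⟩ (fun h => Sum.inl_ne_inr (congrArg Subtype.val h)) ?_ _
    rintro ⟨z | z, rfl⟩
    · exact Or.inl rfl
    · exact Or.inr rfl
  · refine (finprod_two (⟨Quotient.mk _ (Sum.inl x.1), rfl⟩ :
        {o : orbitRel.Quotient G (X ⊕ X) // orbMap (fold X) o = Quotient.mk _ x.1})
      ⟨Quotient.mk _ (Sum.inr x.1), rfl⟩ (fun h => ?_) ?_ _).trans ?_
    · obtain ⟨g, hg⟩ := Quotient.exact (congrArg Subtype.val h)
      exact Sum.inr_ne_inl hg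
    · rintro ⟨o, ho⟩
      induction o using Quotient.inductionOn with
      | h z =>
      have := eq_of_mk_eq x.2 ho
      rcases z with z | z
      · exact Or.inl (Subtype.ext (congrArg (fun z => Quotient.mk _ (Sum.inl z)) this))
      · exact Or.inr (Subtype.ext (congrArg (fun z => Quotient.mk _ (Sum.inr z)) this))
    · exact congrArg₂ (fun a b : Φ => a * b)
        (extFun_of_mem n v (x := Sum.inl x.1) (map_mem_fixedPoints (inl X X) x.2))
        (extFun_of_mem n v (x := Sum.inr x.1) (map_mem_fixedPoints (inr X X) x.2))

theorem tr_id [Finite X] (v : Obj G R Φ X) : tr (MulActionHom.id G) v = v := by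
  refine ext (fun x => ?_) fun x => ?_
  · have : Unique {z : X // MulActionHom.id G z = x} := ⟨⟨⟨x, rfl⟩⟩, fun z => Subtype.ext z.2⟩
    exact (finsum_unique _).trans (congrArg v.1.1 (default : {z : X // MulActionHom.id G z = x}).2)
  · have : Unique {z : fixedPoints G X // MulActionHom.id G z.1 = x.1} :=
      ⟨⟨⟨x, rfl⟩⟩, fun z => Subtype.ext (Subtype.ext z.2)⟩
    exact (finsum_unique _).trans (congrArg v.2 (Subtype.ext
      (default : {z : fixedPoints G X // MulActionHom.id G z.1 = x.1}).2))

theorem nm_id [Finite X] (v : Obj G R Φ X) : nm n hn (MulActionHom.id G) v = v := by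
  refine ext (fun x => ?_) fun x => ?_
  · have : Unique {z : X // MulActionHom.id G z = x} := ⟨⟨⟨x, rfl⟩⟩, fun z => Subtype.ext z.2⟩
    exact (finprod_unique _).trans (congrArg v.1.1 (default : {z : X // MulActionHom.id G z = x}).2)
  · have hid : ∀ o : orbitRel.Quotient G X, orbMap (MulActionHom.id G) o = o := fun o => by
      induction o using Quotient.inductionOn with
      | h z => rfl
    have : Unique {o : orbitRel.Quotient G X // orbMap (MulActionHom.id G) o = Quotient.mk _ x.1} :=
      ⟨⟨⟨Quotient.mk _ x.1, rfl⟩⟩, fun z => Subtype.ext ((hid z.1).symm.trans z.2)⟩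
    refine (finprod_unique _).trans ?_
    rw [← extFun_of_mem n v x.2, ← orbFun_mk n hn]
    exact congrArg _ ((hid _).symm.trans
      (default : {o : orbitRel.Quotient G X // orbMap (MulActionHom.id G) o = Quotient.mk _ x.1}).2)

theorem tr_empty [Finite X] [IsEmpty X] (f : X →[G] Y) (v : Obj G R Φ X) : tr f v = 0 :=
  ext (fun _ => finsum_of_isEmpty _) fun _ => finsum_of_isEmpty _

theorem nm_empty [Finite X] [IsEmpty X] (f : X →[G] Y) (v : Obj G R Φ X) : nm n hn f v = 1 := by
  have : IsEmpty (orbitRel.Quotient G X) := ⟨fun o => isEmptyElim o.out⟩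
  exact ext (fun _ => finprod_of_isEmpty _) fun _ => finprod_of_isEmpty _

end Ghost

open GSet in
/-- The ghost of `T`, for `G` of prime order: the Tambara functor with value
`Map_G(X, T(G/e)) × Map(X^G, Φ^G T)` at `X`. Its value at `G/e` is `T(G/e)`, its value at `G/G` is
`T(G/e)^G × Φ^G T`, the restriction between them is the first projection, the transfer is
`a ↦ (∑ g • a, 0)` and the norm is `a ↦ (∏ g • a, nm(a) + τ)`. -/
noncomputable def TambaraFunctor.ghost {G : Type} [Group G] [Finite G] (T : TambaraFunctor.{u} G)
    (hG : (Nat.card G).Prime) : TambaraFunctor.{u} G where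
  obj X _ _ := Ghost.Obj G T.Bot T.GeomFixed X
  res f := Ghost.res f
  tr f := Ghost.tr f
  nm f := Ghost.nm (T.nmGeom hG) (T.nmGeom_smul hG) f
  res_id _ := rfl
  tr_id := Ghost.tr_id
  nm_id := Ghost.nm_id _ _
  res_comp _ _ _ := rfl
  tr_comp := Ghost.tr_comp
  nm_comp := Ghost.nm_comp _ _ hG
  res_tr := Ghost.res_tr
  res_nm := Ghost.res_nm _ _
  nm_tr := Ghost.nm_tr _ _ hG
  subsingleton_obj _ _ _ _ := ⟨fun _ _ => Ghost.ext (fun x => isEmptyElim x)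
    fun x => isEmptyElim x.1⟩
  bijective_res X Y := Ghost.bijective_res X Y
  tr_empty := Ghost.tr_empty
  nm_empty := Ghost.nm_empty _ _
  tr_fold := Ghost.tr_fold
  nm_fold := Ghost.nm_fold _ _

/-! The Lewis diagram of the ghost. -/

namespace TambaraFunctor

open GSet MulAction

variable {G : Type} [Group G] [Finite G] (T : TambaraFunctor.{u} G) (hG : (Nat.card G).Prime)

theorem mem_fixedPoints_top (x : G ⧸ (⊤ : Subgroup G)) :
    x ∈ fixedPoints G (G ⧸ (⊤ : Subgroup G)) := fun _ => Subsingleton.elim _ _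

theorem not_mem_fixedPoints_bot (hG : (Nat.card G).Prime) (x : G ⧸ (⊥ : Subgroup G)) :
    x ∉ fixedPoints G (G ⧸ (⊥ : Subgroup G)) := by
  have := (Nat.card_pos_iff.1 hG.pos).2
  have : Nontrivial G := Finite.one_lt_card_iff_nontrivial.1 hG.one_lt
  obtain ⟨g, hg⟩ := exists_ne (1 : G)
  induction x using QuotientGroup.induction_on with
  | H x =>
  intro h
  have h1 := QuotientGroup.eq.1 (h g)
  rw [Subgroup.mem_bot, inv_mul_eq_one] at h1
  exact hg (mul_eq_right.1 h1)

/-- `gh(T)(G/e) ≅ T(G/e)`. -/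
noncomputable def ghostBot : (T.ghost hG).Bot ≃+* T.Bot :=
  RingEquiv.ofBijective
    ({ toFun := fun v : Ghost.Obj G T.Bot T.GeomFixed (G ⧸ (⊥ : Subgroup G)) =>
        v.1.1 ((1 : G) : G ⧸ (⊥ : Subgroup G))
       map_one' := rfl
       map_mul' := fun _ _ => rfl
       map_zero' := rfl
       map_add' := fun _ _ => rfl } :
      Ghost.Obj G T.Bot T.GeomFixed (G ⧸ (⊥ : Subgroup G)) →+* T.Bot) (by
    have hsmul : ∀ g : G, (g : G ⧸ (⊥ : Subgroup G)) = g • ((1 : G) : G ⧸ (⊥ : Subgroup G)) :=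
      fun g => congrArg QuotientGroup.mk (mul_one g).symm
    constructor
    · intro v w h
      refine Ghost.ext (fun x => ?_) fun x => absurd x.2 (not_mem_fixedPoints_bot hG x.1)
      induction x using QuotientGroup.induction_on with
      | H x =>
      rw [hsmul, v.1.2, w.1.2]
      exact congrArg (x • ·) h
    · intro a
      refine ⟨(⟨fun x => (QuotientGroup.quotientBot x : G) • a, fun g x => ?_⟩,
        fun x => absurd x.2 (not_mem_fixedPoints_bot hG x.1)), ?_⟩
      · induction x using QuotientGroup.induction_on with
        | H x => exact mul_smul g x a
      · exact one_smul G a)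

/-- `gh(T)(G/G) ≅ T(G/e)^G × Φ^G T`. -/
noncomputable def ghostTop :
    (T.ghost hG).Top ≃+* FixedPoints.subring T.Bot G × T.GeomFixed :=
  RingEquiv.ofBijective
    ({ toFun := fun v : Ghost.Obj G T.Bot T.GeomFixed (G ⧸ (⊤ : Subgroup G)) =>
        (⟨v.1.1 ((1 : G) : G ⧸ (⊤ : Subgroup G)), fun g => by
            rw [← v.1.2]
            exact congrArg _ (Subsingleton.elim _ _)⟩,
          v.2 ⟨((1 : G) : G ⧸ (⊤ : Subgroup G)), mem_fixedPoints_top _⟩)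
       map_one' := rfl
       map_mul' := fun _ _ => rfl
       map_zero' := rfl
       map_add' := fun _ _ => rfl } :
      Ghost.Obj G T.Bot T.GeomFixed (G ⧸ (⊤ : Subgroup G)) →+*
        FixedPoints.subring T.Bot G × T.GeomFixed) (by
    constructor
    · intro v w h
      refine Ghost.ext (fun x => ?_) fun x => ?_
      · rw [Subsingleton.elim x ((1 : G) : G ⧸ (⊤ : Subgroup G))]
        exact congrArg (fun t => t.1.1) h
      · rw [Subsingleton.elim x ⟨((1 : G) : G ⧸ (⊤ : Subgroup G)), mem_fixedPoints_top _⟩]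
        exact congrArg (fun t => t.2) h
    · rintro ⟨a, b⟩
      exact ⟨(⟨fun _ => a.1, fun g _ => (a.2 g).symm⟩, fun _ => b), rfl⟩)

theorem ghostBot_smul (g : G) (v : (T.ghost hG).Bot) :
    T.ghostBot hG (g • v) = g • T.ghostBot hG v := by
  have h : ((1 * g : G) : G ⧸ (⊥ : Subgroup G)) = g • ((1 : G) : G ⧸ (⊥ : Subgroup G)) :=
    congrArg QuotientGroup.mk ((one_mul g).trans (mul_one g).symm)
  exact (congrArg (Prod.fst v).1 h).trans ((Prod.fst v).2 g _)

theorem ghostBot_res (v : (T.ghost hG).Top) :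
    T.ghostBot hG ((T.ghost hG).res (quot bot_le) v) = (T.ghostTop hG v).1 := rfl

theorem bijective_fiber_quot : Function.Bijective fun g : G =>
    (⟨(g : G ⧸ (⊥ : Subgroup G)), Subsingleton.elim _ _⟩ :
      {x : G ⧸ (⊥ : Subgroup G) // quot (G := G) bot_le x = ((1 : G) : G ⧸ (⊤ : Subgroup G))}) := by
  constructor
  · intro g h hgh
    have := QuotientGroup.eq.1 (congrArg Subtype.val hgh)
    rwa [Subgroup.mem_bot, inv_mul_eq_one] at this
  · rintro ⟨x, hx⟩
    induction x using QuotientGroup.induction_on with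
    | H x => exact ⟨x, rfl⟩

theorem ghostBot_apply (v : (T.ghost hG).Bot) (g : G) :
    (Prod.fst v : Ghost.equivariantFun G _ T.Bot).1 (g : G ⧸ (⊥ : Subgroup G)) =
      g • T.ghostBot hG v := by
  have h : (g : G ⧸ (⊥ : Subgroup G)) = g • ((1 : G) : G ⧸ (⊥ : Subgroup G)) :=
    congrArg QuotientGroup.mk (mul_one g).symm
  rw [h]
  exact (Prod.fst v).2 g _

theorem ghostTop_tr (v : (T.ghost hG).Bot) :
    ((T.ghostTop hG ((T.ghost hG).tr (quot bot_le) v)).1 : T.Bot) =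
        ∑ᶠ g : G, g • T.ghostBot hG v ∧
      (T.ghostTop hG ((T.ghost hG).tr (quot bot_le) v)).2 = 0 := by
  constructor
  · exact (finsum_eq_of_bijective _ bijective_fiber_quot
      fun g => (ghostBot_apply T hG v g).symm).symm
  · have : IsEmpty {x : fixedPoints G (G ⧸ (⊥ : Subgroup G)) //
        quot (G := G) bot_le x.1 = ((1 : G) : G ⧸ (⊤ : Subgroup G))} :=
      ⟨fun x => not_mem_fixedPoints_bot hG _ x.1.2⟩
    exact finsum_of_isEmpty _

theorem ghostTop_nm (v : (T.ghost hG).Bot) :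
    ((T.ghostTop hG ((T.ghost hG).nm (quot bot_le) v)).1 : T.Bot) =
        ∏ᶠ g : G, g • T.ghostBot hG v ∧
      (T.ghostTop hG ((T.ghost hG).nm (quot bot_le) v)).2 = T.nmGeom hG (T.ghostBot hG v) := by
  constructor
  · exact (finprod_eq_of_bijective _ bijective_fiber_quot
      fun g => (ghostBot_apply T hG v g).symm).symm
  · let _ : Unique {o : orbitRel.Quotient G (G ⧸ (⊥ : Subgroup G)) //
        Ghost.orbMap (quot (G := G) bot_le) o =
          Quotient.mk _ ((1 : G) : G ⧸ (⊤ : Subgroup G))} :=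
      { default := ⟨Quotient.mk _ ((1 : G) : G ⧸ (⊥ : Subgroup G)), rfl⟩
        uniq := by
          rintro ⟨o, ho⟩
          induction o using Quotient.inductionOn with
          | h x =>
          induction x using QuotientGroup.induction_on with
          | H x =>
          exact Subtype.ext (Quotient.sound ⟨x, congrArg QuotientGroup.mk (mul_one x)⟩) }
    exact (finprod_unique _).trans
      (Ghost.extFun_of_not_mem (T.nmGeom hG) v (x := ((1 : G) : G ⧸ (⊥ : Subgroup G)))
        (not_mem_fixedPoints_bot hG _))

end TambaraFunctor

namespace Order

theorem exists_gt_of_succ_le_coheight {α : Type*} [Preorder α] {a : α} {n : ℕ}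
    (h : ((n + 1 : ℕ) : ℕ∞) ≤ coheight a) : ∃ b > a, (n : ℕ∞) ≤ coheight b := by
  by_contra! hb
  have h1 := h.trans (coheight_le_coe_iff.2 hb)
  exact absurd (Nat.cast_le.1 h1) (by omega)

/-- If every step up from `a` can be matched by a step up from a related `b`, then the coheight
grows along the relation. -/
theorem coheight_le_coheight_of_simulation {α β : Type*} [Preorder α] [Preorder β]
    (r : α → β → Prop) (hr : ∀ a a' b, r a b → a < a' → ∃ b', b < b' ∧ r a' b') {a : α} {b : β}
    (hab : r a b) : coheight a ≤ coheight b := by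
  refine ENat.forall_natCast_le_iff_le.1 fun n hn => ?_
  induction n generalizing a b with
  | zero => exact zero_le
  | succ n ih =>
    obtain ⟨a', ha, hn'⟩ := exists_gt_of_succ_le_coheight hn
    obtain ⟨b', hb, hab'⟩ := hr a a' b hab ha
    push_cast
    exact (add_le_add_left (ih hab' hn') 1).trans (coheight_add_one_le hb)

end Order

namespace RingHom.IsIntegral

variable {R S : Type*} [CommRing R] [CommRing S] {f : R →+* S}

theorem comap_lt_comap (hf : f.IsIntegral) {P Q : Ideal S} [P.IsPrime] (h : P < Q) :
    P.comap f < Q.comap f := by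
  algebraize [f]
  exact Ideal.IsIntegral.comap_lt_comap h

theorem exists_prime_comap_eq (hf : f.IsIntegral) {p : Ideal R} [p.IsPrime] {I : Ideal S}
    (h : I.comap f ≤ p) : ∃ Q ≥ I, Q.IsPrime ∧ Q.comap f = p := by
  algebraize [f]
  exact Ideal.exists_ideal_over_prime_of_isIntegral p I h

theorem ringKrullDim_le (hf : f.IsIntegral) : ringKrullDim S ≤ ringKrullDim R :=
  Order.krullDim_le_of_strictMono (PrimeSpectrum.comap f) fun _ _ h => hf.comap_lt_comap h

theorem exists_gt_comap_eq (hf : f.IsIntegral) (p p' : PrimeSpectrum R) (q : PrimeSpectrum S)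
    (hq : q.asIdeal.comap f = p.asIdeal) (hp : p < p') :
    ∃ q', q < q' ∧ q'.asIdeal.comap f = p'.asIdeal := by
  have hle : q.asIdeal.comap f ≤ p'.asIdeal := hq.trans_le hp.le
  obtain ⟨Q, hQ, hQp, hQc⟩ := hf.exists_prime_comap_eq hle
  refine ⟨⟨Q, hQp⟩, lt_of_le_of_ne hQ ?_, hQc⟩
  rintro rfl
  exact hp.ne (PrimeSpectrum.ext (hq.symm.trans hQc))

theorem coheight_le_coheight (hf : f.IsIntegral) (p : PrimeSpectrum R) (q : PrimeSpectrum S)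
    (hq : q.asIdeal.comap f = p.asIdeal) : Order.coheight p ≤ Order.coheight q :=
  Order.coheight_le_coheight_of_simulation
    (fun (p : PrimeSpectrum R) (q : PrimeSpectrum S) => q.asIdeal.comap f = p.asIdeal)
    (fun p p' q hq hp => hf.exists_gt_comap_eq p p' q hq hp) hq

theorem ringKrullDim_eq (hf : f.IsIntegral) (hinj : Function.Injective f) :
    ringKrullDim R = ringKrullDim S := by
  refine le_antisymm ?_ hf.ringKrullDim_le
  change Order.krullDim (PrimeSpectrum R) ≤ Order.krullDim (PrimeSpectrum S)
  rw [Order.krullDim_eq_iSup_coheight (α := PrimeSpectrum R)]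
  refine iSup_le fun p => ?_
  have hle : (⊥ : Ideal S).comap f ≤ p.asIdeal := by
    rw [← RingHom.ker_eq_comap_bot, (RingHom.injective_iff_ker_eq_bot f).1 hinj]
    exact bot_le
  obtain ⟨Q, -, hQp, hQc⟩ := hf.exists_prime_comap_eq hle
  exact (WithBot.coe_le_coe.2 (hf.coheight_le_coheight p ⟨Q, hQp⟩ hQc)).trans
    (Order.coheight_le_krullDim _)

end RingHom.IsIntegral

/-! ### Intersections of orbits of prime ideals -/

namespace Ideal

variable (G : Type) [Group G] {R : Type*} [CommRing R] [MulSemiringAction G R]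

/-- The intersection of the translates of `p`. -/
def orbitInf (p : Ideal R) : Ideal R := ⨅ g : G, p.comap (MulSemiringAction.toRingHom G R g)

/-- The ideal `I` is the intersection of the translates of a prime ideal. -/
def IsOrbitPrime (I : Ideal R) : Prop := ∃ p : Ideal R, p.IsPrime ∧ I = orbitInf G p

variable {G}

theorem mem_orbitInf {p : Ideal R} {a : R} : a ∈ orbitInf G p ↔ ∀ g : G, g • a ∈ p := by
  simp [orbitInf]

theorem orbitInf_le (p : Ideal R) : orbitInf G p ≤ p := fun a ha => by
  simpa using mem_orbitInf.1 ha 1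

theorem smul_mem_orbitInf {p : Ideal R} {a : R} (ha : a ∈ orbitInf G p) (g : G) :
    g • a ∈ orbitInf G p :=
  mem_orbitInf.2 fun h => by
    rw [smul_smul]
    exact mem_orbitInf.1 ha _

theorem le_orbitInf {I p : Ideal R} (hI : ∀ (g : G), ∀ a ∈ I, g • a ∈ I) (h : I ≤ p) :
    I ≤ orbitInf G p := fun a ha => mem_orbitInf.2 fun g => h (hI g a ha)

theorem orbitInf_comap_smul (p : Ideal R) (g : G) :
    orbitInf G (p.comap (MulSemiringAction.toRingHom G R g)) = orbitInf G p := by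
  ext a
  simp only [mem_orbitInf, Ideal.mem_comap, MulSemiringAction.toRingHom_apply, smul_smul]
  exact ⟨fun h k => by simpa using h (g⁻¹ * k), fun h k => h _⟩

theorem IsOrbitPrime.smul_mem {I : Ideal R} (hI : IsOrbitPrime G I) (g : G) {a : R} (ha : a ∈ I) :
    g • a ∈ I := by
  obtain ⟨p, -, rfl⟩ := hI
  exact smul_mem_orbitInf ha g

theorem IsOrbitPrime.ne_top {I : Ideal R} (hI : IsOrbitPrime G I) : I ≠ ⊤ := by
  obtain ⟨p, hp, rfl⟩ := hI
  exact fun h => hp.ne_top (top_le_iff.1 (h ▸ orbitInf_le p))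

theorem IsOrbitPrime.le_or_le {I A B : Ideal R} (hI : IsOrbitPrime G I)
    (hA : ∀ (g : G), ∀ a ∈ A, g • a ∈ A) (hB : ∀ (g : G), ∀ a ∈ B, g • a ∈ B) (h : A * B ≤ I) :
    A ≤ I ∨ B ≤ I := by
  obtain ⟨p, hp, rfl⟩ := hI
  exact (hp.mul_le.1 (h.trans (orbitInf_le p))).imp (le_orbitInf hA) (le_orbitInf hB)

variable [Finite G]

/-- Going up for intersections of orbits of primes. -/
theorem IsOrbitPrime.exists_prime_ge {I : Ideal R} (hI : IsOrbitPrime G I) {p : Ideal R}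
    (h : orbitInf G p ≤ I) : ∃ p' ≥ p, p'.IsPrime ∧ I = orbitInf G p' := by
  cases nonempty_fintype G
  obtain ⟨q, hq, rfl⟩ := hI
  have h1 : (Finset.univ.inf fun g : G => p.comap (MulSemiringAction.toRingHom G R g)) ≤ q := by
    rw [Finset.inf_univ_eq_iInf]
    exact h.trans (orbitInf_le q)
  obtain ⟨g, -, hg⟩ := hq.inf_le'.1 h1
  refine ⟨q.comap (MulSemiringAction.toRingHom G R g⁻¹), fun a ha => ?_, inferInstance,
    (orbitInf_comap_smul q _).symm⟩
  apply hg
  simpa using ha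

/-- An invariant proper ideal that is prime with respect to invariant ideals is the intersection of
an orbit of primes. -/
theorem isOrbitPrime_of_forall {I : Ideal R} (hI : ∀ (g : G), ∀ a ∈ I, g • a ∈ I) (hne : I ≠ ⊤)
    (h : ∀ A B : Ideal R, (∀ (g : G), ∀ a ∈ A, g • a ∈ A) → (∀ (g : G), ∀ a ∈ B, g • a ∈ B) →
      A * B ≤ I → A ≤ I ∨ B ≤ I) : IsOrbitPrime G I := by
  obtain ⟨p, hIp, hp⟩ := zorn_le_nonempty₀ {p : Ideal R | orbitInf G p ≤ I}
    (fun c hc hchain y hy => by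
    refine ⟨sSup c, fun a ha => ?_, fun z hz => le_sSup hz⟩
    have hd : DirectedOn (· ≤ ·) c := hchain.directedOn
    have h1 : ∀ g : G, ∃ z ∈ c, g • a ∈ z := fun g =>
      (Submodule.mem_sSup_of_directed ⟨y, hy⟩ hd).1 (mem_orbitInf.1 ha g)
    choose z hz haz using h1
    have : Nonempty c := ⟨⟨y, hy⟩⟩
    obtain ⟨w, hw⟩ := (directedOn_iff_directed.1 hd).finite_le fun g : G => (⟨z g, hz g⟩ : c)
    exact hc w.2 (mem_orbitInf.2 fun g => hw g (haz g))) I (orbitInf_le I)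
  have heq : I = orbitInf G p := le_antisymm (le_orbitInf hI hIp) hp.1
  refine ⟨p, ⟨fun htop => hne ?_, fun {x y} hxy => ?_⟩, heq⟩
  · rw [heq, htop]
    exact top_le_iff.1 fun a _ => mem_orbitInf.2 fun g => trivial
  · by_contra! hn
    have key : ∀ x, x ∉ p → ¬ orbitInf G (p ⊔ span {x}) ≤ I := fun x hx hle =>
      hx (hp.2 hle le_sup_left ((le_sup_right : _ ≤ p ⊔ span {x}) (mem_span_singleton_self x)))
    refine (h (orbitInf G (p ⊔ span {x})) (orbitInf G (p ⊔ span {y}))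
      (fun g a ha => smul_mem_orbitInf ha g) (fun g a ha => smul_mem_orbitInf ha g) ?_).elim
      (key x hn.1) (key y hn.2)
    rw [heq]
    refine Ideal.mul_le.2 fun a ha b hb => mem_orbitInf.2 fun g => ?_
    rw [smul_mul']
    have hle : (p ⊔ span {x}) * (p ⊔ span {y}) ≤ p := by
      rw [Ideal.sup_mul, Ideal.mul_sup, Ideal.mul_sup, span_singleton_mul_span_singleton]
      refine sup_le (sup_le Ideal.mul_le_right Ideal.mul_le_left) (sup_le Ideal.mul_le_right ?_)
      rwa [span_singleton_le_iff_mem]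
    exact hle (Ideal.mul_mem_mul (mem_orbitInf.1 ha g) (mem_orbitInf.1 hb g))

end Ideal

/-! ### The model of the spectrum of the ghost -/

namespace Ghost

variable (G : Type) [Group G] {R Φ : Type u} [CommRing R] [MulSemiringAction G R] [CommRing Φ]

/-- The prime spectrum of the ghost attached to `n : R → Φ`: the intersections `I` of orbits of
primes of `R`, coded as `(I, ⊤)`, and the primes `q` of `Φ`, coded as `(n⁻¹ q, q)`. -/
def Model (n : R →+* Φ) : Type u :=
  {x : Ideal R × Ideal Φ //
    (x.1.IsOrbitPrime G ∧ x.2 = ⊤) ∨ (x.2.IsPrime ∧ x.1 = x.2.comap n)}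

instance (n : R →+* Φ) : PartialOrder (Model G n) :=
  inferInstanceAs (PartialOrder {x : Ideal R × Ideal Φ //
    (x.1.IsOrbitPrime G ∧ x.2 = ⊤) ∨ (x.2.IsPrime ∧ x.1 = x.2.comap n)})

namespace Model

variable {G} {n : R →+* Φ}

theorem lt_iff_le_and_ne (x y : Model G n) :
    x < y ↔ x.1.1 ≤ y.1.1 ∧ x.1.2 ≤ y.1.2 ∧ ¬(x.1.1 = y.1.1 ∧ x.1.2 = y.1.2) := by
  rw [_root_.lt_iff_le_and_ne, ← and_assoc]
  exact and_congr Iff.rfl (not_congr (Subtype.ext_iff.trans Prod.ext_iff))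

theorem le_comap (x : Model G n) : x.1.1 ≤ x.1.2.comap n := by
  rcases x.2 with ⟨-, h⟩ | ⟨-, h⟩
  · rw [h]
    exact le_top
  · exact h.le

theorem smul_mem (hn : ∀ (g : G) r, n (g • r) = n r) (x : Model G n) (g : G) {a : R}
    (ha : a ∈ x.1.1) : g • a ∈ x.1.1 := by
  rcases x.2 with ⟨h, -⟩ | ⟨-, h⟩
  · exact h.smul_mem g ha
  · rw [h, Ideal.mem_comap] at ha ⊢
    rwa [hn]

variable [Finite G]

theorem exists_gt_of_orbitPrime (x x' : Model G n) (p : PrimeSpectrum R)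
    (hp : x.1.1 = p.asIdeal.orbitInf G ∧ x.1.2 = ⊤) (h : x < x') :
    ∃ p', p < p' ∧ x'.1.1 = p'.asIdeal.orbitInf G ∧ x'.1.2 = ⊤ := by
  obtain ⟨h1, h2, h3⟩ := (lt_iff_le_and_ne x x').1 h
  rw [hp.2, top_le_iff] at h2
  rcases x'.2 with ⟨h4, -⟩ | ⟨h4, -⟩
  · obtain ⟨p', hle, hp', heq⟩ := h4.exists_prime_ge (hp.1.symm.trans_le h1)
    refine ⟨⟨p', hp'⟩, lt_of_le_of_ne hle ?_, heq, h2⟩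
    rintro rfl
    exact h3 ⟨hp.1.trans heq.symm, hp.2.trans h2.symm⟩
  · exact absurd h2 h4.ne_top

theorem coheight_le_of_orbitPrime (x : Model G n) (p : PrimeSpectrum R)
    (hp : x.1.1 = p.asIdeal.orbitInf G) (hx : x.1.2 = ⊤) :
    Order.coheight x ≤ Order.coheight p :=
  Order.coheight_le_coheight_of_simulation
    (fun (x : Model G n) (p : PrimeSpectrum R) => x.1.1 = p.asIdeal.orbitInf G ∧ x.1.2 = ⊤)
    (fun x x' p hp h => exists_gt_of_orbitPrime x x' p hp h) ⟨hp, hx⟩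

theorem coheight_le_of_prime (hn : n.IsIntegral) (x : Model G n) (q : PrimeSpectrum Φ)
    (hq : x.1.2 = q.asIdeal) (hx : x.1.1 = q.asIdeal.comap n) :
    Order.coheight x ≤ Order.coheight q + 1 := by
  refine ENat.forall_natCast_le_iff_le.1 fun k hk => ?_
  induction k generalizing x q with
  | zero => exact zero_le
  | succ k ih =>
    obtain ⟨x', hlt, hk'⟩ := Order.exists_gt_of_succ_le_coheight hk
    obtain ⟨h1, h2, h3⟩ := (lt_iff_le_and_ne x x').1 hlt
    push_cast
    refine add_le_add_left ?_ 1
    rcases x'.2 with ⟨h4, h5⟩ | ⟨h4, h5⟩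
    · obtain ⟨p, hp, heq⟩ := h4
      have hle : q.asIdeal.comap n ≤ p :=
        hx.symm.trans_le (h1.trans (heq.trans_le (Ideal.orbitInf_le p)))
      obtain ⟨Q, hQ, hQp, hQc⟩ := hn.exists_prime_comap_eq hle
      calc (k : ℕ∞) ≤ Order.coheight x' := hk'
        _ ≤ Order.coheight (⟨p, hp⟩ : PrimeSpectrum R) := coheight_le_of_orbitPrime x' _ heq h5
        _ ≤ Order.coheight (⟨Q, hQp⟩ : PrimeSpectrum Φ) := hn.coheight_le_coheight _ _ hQc
        _ ≤ Order.coheight q := Order.coheight_anti hQ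
    · have hlt' : q < ⟨x'.1.2, h4⟩ := by
        refine lt_of_le_of_ne (hq.symm.trans_le h2) ?_
        rintro rfl
        exact h3 ⟨hx.trans h5.symm, hq⟩
      exact (ih x' _ rfl h5 hk').trans (Order.coheight_add_one_le hlt')

theorem krullDim_le (hn : n.IsIntegral) :
    Order.krullDim (Model G n) ≤ max (ringKrullDim R) (ringKrullDim Φ + 1) := by
  rw [Order.krullDim_eq_iSup_coheight]
  refine iSup_le fun x => ?_
  rcases x.2 with ⟨⟨p, hp, heq⟩, h⟩ | ⟨hp, h⟩
  · exact le_max_of_le_left ((WithBot.coe_le_coe.2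
      (coheight_le_of_orbitPrime x ⟨p, hp⟩ heq h)).trans (Order.coheight_le_krullDim _))
  · refine le_max_of_le_right ((WithBot.coe_le_coe.2
      (coheight_le_of_prime hn x ⟨x.1.2, hp⟩ rfl h)).trans ?_)
    push_cast
    exact add_le_add_left (Order.coheight_le_krullDim _) 1

/-- Transport of the model along an equivariant isomorphism. -/
theorem krullDim_le_of_ringEquiv {R' : Type u} [CommRing R'] [MulSemiringAction G R']
    (e : R' ≃+* R) (he : ∀ (g : G) a, e (g • a) = g • e a) :
    Order.krullDim (Model G n) ≤ Order.krullDim (Model G (n.comp e.toRingHom)) := by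
  have hinf : ∀ p : Ideal R, (p.orbitInf G).comap e.toRingHom =
      (p.comap e.toRingHom).orbitInf G := fun p => by
    ext a
    simp [Ideal.mem_orbitInf, he]
  have hle : ∀ {I J : Ideal R}, I.comap e.toRingHom ≤ J.comap e.toRingHom → I ≤ J :=
    fun h => (Ideal.comap_le_comap_iff_of_surjective _ e.surjective _ _).1 h
  refine Order.krullDim_le_of_strictMono (fun x => ⟨(x.1.1.comap e.toRingHom, x.1.2), ?_⟩) ?_
  · rcases x.2 with ⟨⟨p, hp, heq⟩, h⟩ | ⟨hp, h⟩
    · refine Or.inl ⟨⟨p.comap e.toRingHom, inferInstance, ?_⟩, h⟩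
      rw [← hinf, ← heq]
    · refine Or.inr ⟨hp, ?_⟩
      change x.1.1.comap _ = _
      rw [h, Ideal.comap_comap]
  · intro x y hxy
    refine lt_of_le_not_ge ⟨Ideal.comap_mono hxy.le.1, hxy.le.2⟩ fun h => ?_
    exact hxy.not_ge ⟨hle h.1, h.2⟩

end Model

end Ghost

/-! ### Transfers and norms along disjoint unions -/

namespace GSet

variable {G : Type} [Group G] {ι κ X : Type} [MulAction G X]

/-- The inclusion of a summand `X` of a disjoint union of copies of `X`. -/
def sigmaIncl (i : ι) : X →[G] (_ : ι) × X where
  toFun x := ⟨i, x⟩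
  map_smul' _ _ := rfl

/-- The map of disjoint unions of copies of `X` over a map of index sets. -/
def sigmaMap (f : ι → κ) : ((_ : ι) × X) →[G] (_ : κ) × X where
  toFun x := ⟨f x.1, x.2⟩
  map_smul' _ _ := rfl

/-- The map on a disjoint union of copies of `X` with the given components. -/
def sigmaDesc {Y : Type} [MulAction G Y] (f : ι → X →[G] Y) : ((_ : ι) × X) →[G] Y where
  toFun x := f x.1 x.2
  map_smul' g x := map_smul (f x.1) g x.2

theorem sigmaMap_bijective (e : ι ≃ κ) :
    Function.Bijective (sigmaMap e : ((_ : ι) × X) →[G] (_ : κ) × X) :=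
  Function.bijective_iff_has_inverse.2 ⟨sigmaMap (G := G) e.symm,
    fun x => Sigma.ext (e.symm_apply_apply x.1) HEq.rfl,
    fun x => Sigma.ext (e.apply_symm_apply x.1) HEq.rfl⟩

theorem desc_sigmaMap_bijective :
    Function.Bijective (desc (sigmaMap some) (sigmaIncl none) :
      ((_ : ι) × X) ⊕ X →[G] (_ : Option ι) × X) := by
  constructor
  · rintro (⟨i, x⟩ | x) (⟨j, y⟩ | y) h
    · have h1 : some i = some j := congrArg Sigma.fst h
      have h2 : x = y := congrArg Sigma.snd h
      rw [Option.some.inj h1, h2]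
    · exact absurd (congrArg Sigma.fst h : some i = none) (Option.some_ne_none i)
    · exact absurd (congrArg Sigma.fst h : none = some j) (Option.some_ne_none j).symm
    · exact congrArg Sum.inr (congrArg Sigma.snd h : x = y)
  · rintro ⟨_ | i, x⟩
    · exact ⟨Sum.inr x, rfl⟩
    · exact ⟨Sum.inl ⟨i, x⟩, rfl⟩

end GSet

namespace TambaraFunctor

open GSet

variable {G : Type} [Group G] (T : TambaraFunctor.{u} G)
  {X Y Z : Type} [Finite X] [MulAction G X] [Finite Y] [MulAction G Y] [Finite Z] [MulAction G Z]

theorem tr_sigma (ι : Type) [Fintype ι] (h : ((_ : ι) × X) →[G] Z) (z : T.obj ((_ : ι) × X)) :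
    T.tr h z = ∑ i, T.tr (h.comp (sigmaIncl i)) (T.res (sigmaIncl i) z) := by
  refine Fintype.induction_empty_option (P := fun ι _ => ∀ (h : ((_ : ι) × X) →[G] Z)
    (z : T.obj ((_ : ι) × X)),
      T.tr h z = ∑ i, T.tr (h.comp (sigmaIncl i)) (T.res (sigmaIncl i) z)) ?_ ?_ ?_ ι h z
  · intro α β _ e ih h z
    let _ : Fintype α := Fintype.ofEquiv β e.symm
    rw [← T.tr_res_of_bijective _ (sigmaMap_bijective e) z, ← T.tr_comp,
      T.tr_res_of_bijective _ (sigmaMap_bijective e) z, ih, ← e.sum_comp]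
    refine Finset.sum_congr rfl fun i _ => ?_
    rw [← T.res_comp]
    rfl
  · intro h z
    rw [T.tr_empty, Fintype.sum_empty]
  · intro α _ ih h z
    rw [← T.tr_res_of_bijective _ desc_sigmaMap_bijective z, ← T.tr_comp,
      T.tr_res_of_bijective _ desc_sigmaMap_bijective z, T.tr_sum, ih, Fintype.sum_option,
      add_comm, ← T.res_comp]
    refine congrArg₂ (· + ·) rfl (Finset.sum_congr rfl fun i _ => ?_)
    rw [← T.res_comp, ← T.res_comp]
    rfl

theorem nm_sigma (ι : Type) [Fintype ι] (h : ((_ : ι) × X) →[G] Z) (z : T.obj ((_ : ι) × X)) :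
    T.nm h z = ∏ i, T.nm (h.comp (sigmaIncl i)) (T.res (sigmaIncl i) z) := by
  refine Fintype.induction_empty_option (P := fun ι _ => ∀ (h : ((_ : ι) × X) →[G] Z)
    (z : T.obj ((_ : ι) × X)),
      T.nm h z = ∏ i, T.nm (h.comp (sigmaIncl i)) (T.res (sigmaIncl i) z)) ?_ ?_ ?_ ι h z
  · intro α β _ e ih h z
    let _ : Fintype α := Fintype.ofEquiv β e.symm
    rw [← T.nm_res_of_bijective _ (sigmaMap_bijective e) z, ← T.nm_comp,
      T.nm_res_of_bijective _ (sigmaMap_bijective e) z, ih, ← e.prod_comp]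
    refine Finset.prod_congr rfl fun i _ => ?_
    rw [← T.res_comp]
    rfl
  · intro h z
    rw [T.nm_empty, Fintype.prod_empty]
  · intro α _ ih h z
    rw [← T.nm_res_of_bijective _ desc_sigmaMap_bijective z, ← T.nm_comp,
      T.nm_res_of_bijective _ desc_sigmaMap_bijective z, T.nm_sum, ih, Fintype.prod_option,
      mul_comm, ← T.res_comp]
    refine congrArg₂ (· * ·) rfl (Finset.prod_congr rfl fun i _ => ?_)
    rw [← T.res_comp, ← T.res_comp]
    rfl

/-! ### The double coset formulas for `G/e → G/G` -/

theorem isPullbackSq_quot_bot :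
    IsPullbackSq (sigmaDesc fun g : G => rightMul g) (sigmaDesc fun _ : G => MulActionHom.id G)
      (quot (bot_le : (⊥ : Subgroup G) ≤ ⊤)) (quot (bot_le : (⊥ : Subgroup G) ≤ ⊤)) where
  comm _ := Subsingleton.elim _ _
  exists_unique x y _ := by
    induction x using QuotientGroup.induction_on with
    | H x =>
    induction y using QuotientGroup.induction_on with
    | H y =>
    refine ⟨⟨y⁻¹ * x, (y : G ⧸ (⊥ : Subgroup G))⟩,
      ⟨congrArg QuotientGroup.mk (mul_inv_cancel_left y x), rfl⟩, ?_⟩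
    rintro ⟨g, z⟩ ⟨h1, h2⟩
    obtain rfl : z = (y : G ⧸ (⊥ : Subgroup G)) := h2
    have h3 := QuotientGroup.eq.1
      (show ((y * g : G) : G ⧸ (⊥ : Subgroup G)) = ((x : G) : G ⧸ (⊥ : Subgroup G)) from h1)
    rw [Subgroup.mem_bot, inv_mul_eq_one] at h3
    rw [← h3, inv_mul_cancel_left]

theorem res_quot_tr_quot [Fintype G] (a : T.Bot) :
    T.res (quot (bot_le : (⊥ : Subgroup G) ≤ ⊤)) (T.tr (quot bot_le) a) = ∑ g : G, g • a := by
  rw [T.res_tr _ _ _ _ isPullbackSq_quot_bot, T.tr_sigma]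
  refine Finset.sum_congr rfl fun g _ => ?_
  rw [← T.res_comp]
  exact T.tr_id _

theorem res_quot_nm_quot [Fintype G] (a : T.Bot) :
    T.res (quot (bot_le : (⊥ : Subgroup G) ≤ ⊤)) (T.nm (quot bot_le) a) = ∏ g : G, g • a := by
  rw [T.res_nm _ _ _ _ isPullbackSq_quot_bot, T.nm_sigma]
  refine Finset.prod_congr rfl fun g _ => ?_
  rw [← T.res_comp]
  exact T.nm_id _

/-! ### Frobenius reciprocity -/

/-- The sections, over the fibres of the fold map, of `id ⊔ f` are the points of the source
of `f`. -/
def foldSec (f : X →[G] Y) : X →[G] DepProd (sumMap (MulActionHom.id G : Y →[G] Y) f) (fold (G := G) Y) where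
  toFun x := ⟨f x, fun y _ => Sum.elim (fun y => Sum.inl y) (fun _ => Sum.inr x) y, fun y h => by
    rcases y with y | y
    · rfl
    · exact congrArg Sum.inr h.symm⟩
  map_smul' g x := DepProd.ext' (map_smul f g x) fun y h1 h2 => by
    rcases y with y | y
    · exact congrArg Sum.inl (smul_inv_smul g y).symm
    · rfl

theorem foldSec_bijective (f : X →[G] Y) : Function.Bijective (foldSec f) := by
  constructor
  · intro x x' h
    exact Sum.inr_injective (DepProd.sec_congr h
      (rfl : (Sum.inr (f x) : Y ⊕ Y) = Sum.inr (f x)) rfl (congrArg DepProd.pt h))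
  · intro d
    have h := d.sec_spec (Sum.inr d.pt) rfl
    rcases hx : d.sec (Sum.inr d.pt) rfl with x | x
    · rw [hx] at h
      exact absurd h Sum.inl_ne_inr
    · rw [hx] at h
      have hpt : f x = d.pt := Sum.inr_injective h
      refine ⟨x, DepProd.ext' hpt fun y h1 h2 => ?_⟩
      rcases y with y | y
      · have hy := d.sec_spec (Sum.inl y) h2
        rcases hs : d.sec (Sum.inl y) h2 with z | z
        · rw [hs] at hy
          exact congrArg Sum.inl (Sum.inl_injective hy).symm
        · rw [hs] at hy
          exact absurd hy Sum.inr_ne_inl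
      · obtain rfl : y = d.pt := h2
        exact hx.symm

/-- The pullback of the total space along `foldSec`. -/
def foldTotal (f : X →[G] Y) : X ⊕ X →[G] DepProd.Total (sumMap (MulActionHom.id G : Y →[G] Y) f) (fold (G := G) Y) where
  toFun x := ⟨(sumMap f f x, foldSec f (fold (G := G) X x)), by rcases x with x | x <;> rfl⟩
  map_smul' g x := Subtype.ext (Prod.ext (map_smul (sumMap f f) g x) (by
    change foldSec f (fold (G := G) X (g • x)) = g • foldSec f (fold (G := G) X x)
    rw [map_smul, map_smul]))

theorem isPullbackSq_foldTotal (f : X →[G] Y) :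
    IsPullbackSq (foldTotal f) (fold X) (DepProd.totalSnd (sumMap (MulActionHom.id G : Y →[G] Y) f) (fold (G := G) Y))
      (foldSec f) where
  comm _ := rfl
  exists_unique := by
    rintro ⟨⟨y, d⟩, hd⟩ x h
    obtain rfl : d = foldSec f x := h
    rcases y with y | y
    · obtain rfl : y = f x := hd
      refine ⟨Sum.inl x, ⟨rfl, rfl⟩, ?_⟩
      rintro (z | z) ⟨h1, h2⟩
      · exact congrArg Sum.inl h2
      · exact absurd (congrArg (fun e => e.1.1) h1) Sum.inr_ne_inl
    · obtain rfl : y = f x := hd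
      refine ⟨Sum.inr x, ⟨rfl, rfl⟩, ?_⟩
      rintro (z | z) ⟨h1, h2⟩
      · exact absurd (congrArg (fun e => e.1.1) h1) Sum.inl_ne_inr
      · exact congrArg Sum.inr h2

theorem mul_tr (f : X →[G] Y) (b : T.obj Y) (a : T.obj X) :
    b * T.tr f a = T.tr f (T.res f b * a) := by
  obtain ⟨z, rfl, rfl⟩ := T.exists_pair b a
  set q := sumMap (MulActionHom.id G : Y →[G] Y) f with hq
  have h1 : T.res (inl _ _) z = T.res (inl _ _) (T.tr q z) := by
    rw [T.res_tr _ _ _ _ (isPullbackSq_inl _ _), T.tr_id]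
  conv_lhs => rw [h1, ← T.res_tr _ _ _ _ (isPullbackSq_inr (MulActionHom.id G) _), ← hq,
    ← T.nm_fold, T.nm_tr, ← T.tr_res_of_bijective _ (foldSec_bijective f) (T.nm _ _), ← T.tr_comp,
    T.res_nm _ _ _ _ (isPullbackSq_foldTotal f), T.nm_fold, ← T.res_comp, ← T.res_comp,
    ← T.res_comp]
  rw [← T.res_comp, ← T.res_comp]
  rfl

end TambaraFunctor

/-! ### Ideals of a Tambara functor over a group of prime order -/

namespace GSet

variable {G : Type} [Group G]

theorem exists_eq_rightMul (f : G ⧸ (⊥ : Subgroup G) →[G] G ⧸ (⊥ : Subgroup G)) :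
    ∃ g : G, f = rightMul g := by
  obtain ⟨g, hg⟩ := QuotientGroup.mk_surjective (f ((1 : G) : G ⧸ (⊥ : Subgroup G)))
  refine ⟨g, ?_⟩
  ext x
  induction x using QuotientGroup.induction_on with
  | H x =>
  have h : (x : G ⧸ (⊥ : Subgroup G)) = x • ((1 : G) : G ⧸ (⊥ : Subgroup G)) :=
    congrArg QuotientGroup.mk (mul_one x).symm
  conv_lhs => rw [h, map_smul, ← hg]
  rfl

theorem rightMul_bijective (g : G) : Function.Bijective (rightMul g) := by
  refine Function.bijective_iff_has_inverse.2 ⟨rightMul g⁻¹, fun x => ?_, fun x => ?_⟩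
  · change (rightMul g⁻¹).comp (rightMul g) x = x
    rw [← rightMul_mul, mul_inv_cancel, rightMul_one]
    rfl
  · change (rightMul g).comp (rightMul g⁻¹) x = x
    rw [← rightMul_mul, inv_mul_cancel, rightMul_one]
    rfl

theorem eq_of_hom_top {X : Type} [MulAction G X] (f f' : X →[G] G ⧸ (⊤ : Subgroup G)) : f = f' := by
  ext x
  exact Subsingleton.elim _ _

theorem isEmpty_hom_top_bot [Finite G] (hG : (Nat.card G).Prime) :
    IsEmpty (G ⧸ (⊤ : Subgroup G) →[G] G ⧸ (⊥ : Subgroup G)) :=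
  ⟨fun f => TambaraFunctor.not_mem_fixedPoints_bot hG _ (Ghost.map_mem_fixedPoints f
    (TambaraFunctor.mem_fixedPoints_top ((1 : G) : G ⧸ (⊤ : Subgroup G))))⟩

end GSet

namespace TambaraFunctor

open GSet

variable {G : Type} [Group G] [Finite G] (T : TambaraFunctor.{u} G)

/-- The restriction `T(G/G) → T(G/e)`. -/
def resTop : T.Top →+* T.Bot := T.resHom (quot bot_le)

/-- The transfer `T(G/e) → T(G/G)`. -/
def trBot (a : T.Bot) : T.Top := T.tr (quot bot_le) a

/-- The norm `T(G/e) → T(G/G)`. -/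
def nmBot (a : T.Bot) : T.Top := T.nm (quot bot_le) a

variable {T}

theorem smul_resTop (g : G) (s : T.Top) : g • T.resTop s = T.resTop s := by
  change T.res (rightMul g) (T.res (quot bot_le) s) = T.res (quot bot_le) s
  rw [← T.res_comp, eq_of_hom_top ((quot bot_le).comp (rightMul g)) (quot bot_le)]

theorem nmBot_smul (g : G) (a : T.Bot) : T.nmBot (g • a) = T.nmBot a := by
  change T.nm (quot bot_le) (T.res (rightMul g) a) = T.nm (quot bot_le) a
  conv_lhs => rw [eq_of_hom_top (quot bot_le) ((quot bot_le).comp (rightMul g)), T.nm_comp,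
    T.nm_res_of_bijective _ (rightMul_bijective g)]

theorem resTop_trBot [Fintype G] (a : T.Bot) : T.resTop (T.trBot a) = ∑ g : G, g • a :=
  T.res_quot_tr_quot a

theorem resTop_nmBot [Fintype G] (a : T.Bot) : T.resTop (T.nmBot a) = ∏ g : G, g • a :=
  T.res_quot_nm_quot a

theorem resTop_nmBot_resTop (s : T.Top) :
    T.resTop (T.nmBot (T.resTop s)) = T.resTop (s ^ Nat.card G) := by
  cases nonempty_fintype G
  simp [resTop_nmBot, smul_resTop]

theorem mul_trBot (s : T.Top) (a : T.Bot) : s * T.trBot a = T.trBot (T.resTop s * a) :=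
  T.mul_tr _ s a

theorem resTop_trBot_mem {I : Ideal T.Bot} (hI : ∀ (g : G), ∀ a ∈ I, g • a ∈ I) {a : T.Bot}
    (ha : a ∈ I) : T.resTop (T.trBot a) ∈ I := by
  cases nonempty_fintype G
  rw [resTop_trBot]
  exact I.sum_mem fun g _ => hI g a ha

theorem resTop_nmBot_mem {I : Ideal T.Bot} {a : T.Bot} (ha : a ∈ I) :
    T.resTop (T.nmBot a) ∈ I := by
  cases nonempty_fintype G
  rw [resTop_nmBot]
  refine I.mem_of_dvd (Finset.dvd_prod_of_mem (fun g : G => g • a) (Finset.mem_univ 1)) ?_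
  rwa [one_smul]

namespace TambaraIdeal

theorem le_iff (hG : (Nat.card G).Prime) {P Q : T.TambaraIdeal} :
    P ≤ Q ↔ P.level ⊥ ≤ Q.level ⊥ ∧ P.level ⊤ ≤ Q.level ⊤ := by
  refine ⟨fun h => ⟨h ⊥, h ⊤⟩, fun h H => ?_⟩
  have := Fact.mk hG
  rcases H.eq_bot_or_eq_top_of_prime_card with rfl | rfl
  exacts [h.1, h.2]

theorem mul_le_iff (hG : (Nat.card G).Prime) {I J P : T.TambaraIdeal} :
    I * J ≤ P ↔ I.level ⊥ * J.level ⊥ ≤ P.level ⊥ ∧ I.level ⊤ * J.level ⊤ ≤ P.level ⊤ := by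
  constructor
  · intro h
    have key : ∀ H, I.level H * J.level H ≤ (I * J).level H := fun H =>
      le_iInf₂ fun K hK => hK H
    exact ⟨(key ⊥).trans (h ⊥), (key ⊤).trans (h ⊤)⟩
  · intro h H
    refine iInf₂_le P fun H' => ?_
    have := Fact.mk hG
    rcases H'.eq_bot_or_eq_top_of_prime_card with rfl | rfl
    exacts [h.1, h.2]

theorem smul_mem (P : T.TambaraIdeal) (g : G) {a : T.Bot} (ha : a ∈ P.level ⊥) :
    g • a ∈ P.level ⊥ := P.res_mem (rightMul g) ha

/-- The elements of `T(G/H)` whose restrictions to `G/e` lie in `I` and whose restrictions to `G/G`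
lie in `J`. -/
def pairLevel (I : Ideal T.Bot) (J : Ideal T.Top) (H : Subgroup G) : Ideal (T.obj (G ⧸ H)) :=
  (⨅ f : G ⧸ (⊥ : Subgroup G) →[G] G ⧸ H, I.comap (T.resHom f)) ⊓
    ⨅ f : G ⧸ (⊤ : Subgroup G) →[G] G ⧸ H, J.comap (T.resHom f)

theorem mem_pairLevel {I : Ideal T.Bot} {J : Ideal T.Top} {H : Subgroup G} {a : T.obj (G ⧸ H)} :
    a ∈ pairLevel I J H ↔ (∀ f : G ⧸ (⊥ : Subgroup G) →[G] G ⧸ H, T.res f a ∈ I) ∧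
      ∀ f : G ⧸ (⊤ : Subgroup G) →[G] G ⧸ H, T.res f a ∈ J := by
  simp only [pairLevel, Ideal.mem_inf, Ideal.mem_iInf]
  rfl

theorem pairLevel_bot (hG : (Nat.card G).Prime) {I : Ideal T.Bot} {J : Ideal T.Top}
    (hI : ∀ (g : G), ∀ a ∈ I, g • a ∈ I) : pairLevel I J ⊥ = I := by
  ext a
  rw [mem_pairLevel]
  refine ⟨fun h => ?_, fun h => ⟨fun f => ?_, fun f => (isEmpty_hom_top_bot hG).elim f⟩⟩
  · have := h.1 (MulActionHom.id G)
    rwa [T.res_id] at this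
  · obtain ⟨g, rfl⟩ := exists_eq_rightMul f
    exact hI g a h

theorem pairLevel_top {I : Ideal T.Bot} {J : Ideal T.Top} :
    pairLevel I J ⊤ = J ⊓ I.comap T.resTop := by
  ext a
  rw [mem_pairLevel, Ideal.mem_inf]
  constructor
  · intro h
    have := h.2 (MulActionHom.id G)
    rw [T.res_id] at this
    exact ⟨this, h.1 _⟩
  · intro h
    refine ⟨fun f => ?_, fun f => ?_⟩
    · rw [eq_of_hom_top f (quot bot_le)]
      exact h.2
    · rw [eq_of_hom_top f (MulActionHom.id G), T.res_id]
      exact h.1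

/-- The ideal with value `I` at `G/e` and `J ∩ res⁻¹ I` at `G/G`. -/
def ofPair (hG : (Nat.card G).Prime) (I : Ideal T.Bot) (J : Ideal T.Top)
    (hI : ∀ (g : G), ∀ a ∈ I, g • a ∈ I) (htr : ∀ a ∈ I, T.trBot a ∈ J)
    (hnm : ∀ a ∈ I, T.nmBot a ∈ J) : T.TambaraIdeal where
  level := pairLevel I J
  res_mem f a ha := by
    rw [mem_pairLevel] at ha ⊢
    refine ⟨fun f' => ?_, fun f' => ?_⟩
    · rw [← T.res_comp]
      exact ha.1 _
    · rw [← T.res_comp]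
      exact ha.2 _
  tr_mem {K H} f a ha := by
    have := Fact.mk hG
    rcases H.eq_bot_or_eq_top_of_prime_card with rfl | rfl <;>
      rcases K.eq_bot_or_eq_top_of_prime_card with rfl | rfl
    · obtain ⟨g, rfl⟩ := exists_eq_rightMul f
      rw [tr_of_bijective T _ (rightMul_bijective g)]
      obtain ⟨g', hg'⟩ := exists_eq_rightMul (inv _ (rightMul_bijective g))
      rw [hg', pairLevel_bot hG hI] at *
      exact hI g' a ha
    · exact (isEmpty_hom_top_bot hG).elim f
    · rw [pairLevel_bot hG hI] at ha
      rw [pairLevel_top, eq_of_hom_top f (quot bot_le)]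
      exact ⟨htr a ha, resTop_trBot_mem hI ha⟩
    · rwa [eq_of_hom_top f (MulActionHom.id G), T.tr_id]
  nm_mem {K H} f a ha := by
    have := Fact.mk hG
    rcases H.eq_bot_or_eq_top_of_prime_card with rfl | rfl <;>
      rcases K.eq_bot_or_eq_top_of_prime_card with rfl | rfl
    · obtain ⟨g, rfl⟩ := exists_eq_rightMul f
      rw [nm_of_bijective T _ (rightMul_bijective g)]
      obtain ⟨g', hg'⟩ := exists_eq_rightMul (inv _ (rightMul_bijective g))
      rw [hg', pairLevel_bot hG hI] at *
      exact hI g' a ha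
    · exact (isEmpty_hom_top_bot hG).elim f
    · rw [pairLevel_bot hG hI] at ha
      rw [pairLevel_top, eq_of_hom_top f (quot bot_le)]
      exact ⟨hnm a ha, resTop_nmBot_mem ha⟩
    · rwa [eq_of_hom_top f (MulActionHom.id G), T.nm_id]

section OfPair

variable (hG : (Nat.card G).Prime) {I : Ideal T.Bot} {J : Ideal T.Top}
  (hI : ∀ (g : G), ∀ a ∈ I, g • a ∈ I) (htr : ∀ a ∈ I, T.trBot a ∈ J)
  (hnm : ∀ a ∈ I, T.nmBot a ∈ J)

theorem ofPair_level_bot : (ofPair hG I J hI htr hnm).level ⊥ = I := pairLevel_bot hG hI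

theorem ofPair_level_top : (ofPair hG I J hI htr hnm).level ⊤ = J ⊓ I.comap T.resTop :=
  pairLevel_top

end OfPair

/-! ### Prime ideals -/

theorem level_top_le_comap (P : T.TambaraIdeal) : P.level ⊤ ≤ (P.level ⊥).comap T.resTop :=
  fun _ ha => P.res_mem _ ha

/-- The elements `s` of `T(G/G)` with `s · res⁻¹ P(G/e) ⊆ P(G/G)`. -/
def topColon (P : T.TambaraIdeal) : Ideal T.Top where
  carrier := {s | ∀ x, T.resTop x ∈ P.level ⊥ → s * x ∈ P.level ⊤}
  add_mem' ha hb x hx := by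
    rw [add_mul]
    exact add_mem (ha x hx) (hb x hx)
  zero_mem' x _ := by
    rw [zero_mul]
    exact zero_mem _
  smul_mem' c s hs x hx := by
    rw [smul_eq_mul, mul_assoc]
    exact Ideal.mul_mem_left _ c (hs x hx)

theorem mem_topColon {P : T.TambaraIdeal} {s : T.Top} :
    s ∈ P.topColon ↔ ∀ x, T.resTop x ∈ P.level ⊥ → s * x ∈ P.level ⊤ := Iff.rfl

theorem level_top_le_topColon (P : T.TambaraIdeal) : P.level ⊤ ≤ P.topColon :=
  fun _ hs _ _ => Ideal.mul_mem_right _ _ hs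

theorem trBot_mem_topColon (P : T.TambaraIdeal) (a : T.Bot) : T.trBot a ∈ P.topColon := fun x hx => by
  rw [mul_comm, mul_trBot]
  exact P.tr_mem _ (Ideal.mul_mem_right _ _ hx)

namespace IsPrime

variable {P : T.TambaraIdeal} (hP : P.IsPrime) (hG : (Nat.card G).Prime)

include hP hG

theorem level_bot_ne_top : P.level ⊥ ≠ ⊤ := by
  intro h
  have h1 : T.nmBot 1 ∈ P.level ⊤ := P.nm_mem _ (h ▸ Submodule.mem_top)
  have h2 : T.nmBot 1 = 1 := T.nm_one _
  rw [h2, ← Ideal.eq_top_iff_one] at h1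
  obtain ⟨H, hH⟩ := hP.proper
  have := Fact.mk hG
  rcases H.eq_bot_or_eq_top_of_prime_card with rfl | rfl
  exacts [hH h, hH h1]

theorem isOrbitPrime_level_bot : (P.level ⊥).IsOrbitPrime G := by
  refine Ideal.isOrbitPrime_of_forall (fun g a ha => P.smul_mem g ha) (hP.level_bot_ne_top hG)
    fun A B hA hB hAB => ?_
  let gen : Ideal T.Bot → Set T.Top := fun A => {x | ∃ a ∈ A, x = T.trBot a ∨ x = T.nmBot a}
  have h1 : ∀ A : Ideal T.Bot, ∀ a ∈ A, T.trBot a ∈ Ideal.span (gen A) := fun A a ha =>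
    Ideal.subset_span ⟨a, ha, Or.inl rfl⟩
  have h2 : ∀ A : Ideal T.Bot, ∀ a ∈ A, T.nmBot a ∈ Ideal.span (gen A) := fun A a ha =>
    Ideal.subset_span ⟨a, ha, Or.inr rfl⟩
  refine (hP.le_or_le (ofPair hG A _ hA (h1 A) (h2 A)) (ofPair hG B _ hB (h1 B) (h2 B)) ?_).imp
    (fun h => (ofPair_level_bot hG hA (h1 A) (h2 A)).symm.trans_le (h ⊥))
    (fun h => (ofPair_level_bot hG hB (h1 B) (h2 B)).symm.trans_le (h ⊥))
  rw [mul_le_iff hG, ofPair_level_bot, ofPair_level_bot, ofPair_level_top, ofPair_level_top]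
  refine ⟨hAB, (Ideal.mul_mono inf_le_left inf_le_left).trans ?_⟩
  rw [Ideal.span_mul_span', Ideal.span_le]
  have htr : ∀ a ∈ A, ∀ b ∈ B, T.trBot (a * b) ∈ P.level ⊤ := fun a ha b hb =>
    P.tr_mem _ (hAB (Ideal.mul_mem_mul ha hb))
  rintro _ ⟨_, ⟨a, ha, rfl | rfl⟩, _, ⟨b, hb, rfl | rfl⟩, rfl⟩
  · change T.trBot a * T.trBot b ∈ P.level ⊤
    rw [mul_comm, mul_trBot, mul_comm]
    exact htr a ha _ (resTop_trBot_mem hB hb)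
  · change T.trBot a * T.nmBot b ∈ P.level ⊤
    rw [mul_comm, mul_trBot, mul_comm]
    exact htr a ha _ (resTop_nmBot_mem hb)
  · change T.nmBot a * T.trBot b ∈ P.level ⊤
    rw [mul_trBot]
    exact htr _ (resTop_nmBot_mem ha) b hb
  · change T.nm _ a * T.nm _ b ∈ P.level ⊤
    rw [← T.nm_mul]
    exact P.nm_mem _ (hAB (Ideal.mul_mem_mul ha hb))

theorem mem_or_mem {x y : T.Top} (hx : T.resTop x ∈ P.level ⊥) (hy : T.resTop y ∈ P.level ⊥)
    (hxy : x * y ∈ P.level ⊤) : x ∈ P.level ⊤ ∨ y ∈ P.level ⊤ := by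
  have hinv : ∀ (g : G), ∀ a ∈ P.level ⊥, g • a ∈ P.level ⊥ := fun g a ha => P.smul_mem g ha
  have h1 : ∀ x : T.Top, ∀ a ∈ P.level ⊥, T.trBot a ∈ P.level ⊤ ⊔ Ideal.span {x} := fun x a ha =>
    (le_sup_left : P.level ⊤ ≤ _) (P.tr_mem _ ha)
  have h2 : ∀ x : T.Top, ∀ a ∈ P.level ⊥, T.nmBot a ∈ P.level ⊤ ⊔ Ideal.span {x} := fun x a ha =>
    (le_sup_left : P.level ⊤ ≤ _) (P.nm_mem _ ha)
  have key : ∀ x, T.resTop x ∈ P.level ⊥ → ofPair hG _ _ hinv (h1 x) (h2 x) ≤ P →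
      x ∈ P.level ⊤ := fun x hx h => by
    have h3 := h ⊤
    rw [ofPair_level_top] at h3
    exact h3 ⟨(le_sup_right : _ ≤ P.level ⊤ ⊔ Ideal.span {x}) (Ideal.mem_span_singleton_self x), hx⟩
  refine (hP.le_or_le _ _ ?_).imp (key x hx) (key y hy)
  rw [mul_le_iff hG, ofPair_level_bot, ofPair_level_bot, ofPair_level_top, ofPair_level_top]
  refine ⟨Ideal.mul_le_left, (Ideal.mul_mono inf_le_left inf_le_left).trans ?_⟩
  rw [Ideal.sup_mul]
  refine sup_le Ideal.mul_le_left ?_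
  rw [Ideal.mul_sup, Ideal.span_singleton_mul_span_singleton]
  exact sup_le Ideal.mul_le_right ((Ideal.span_singleton_le_iff_mem _).2 hxy)

theorem topColon_inf : P.topColon ⊓ (P.level ⊥).comap T.resTop = P.level ⊤ := by
  refine le_antisymm (fun x hx => ?_) (le_inf P.level_top_le_topColon P.level_top_le_comap)
  exact (hP.mem_or_mem hG hx.2 hx.2 (hx.1 x hx.2)).elim id id

theorem topColon_isPrime (h : P.topColon ≠ ⊤) : P.topColon.IsPrime := by
  refine ⟨h, fun {s t} hst => ?_⟩
  by_contra! hn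
  simp only [mem_topColon, not_forall] at hn
  obtain ⟨⟨x, hx, hsx⟩, y, hy, hty⟩ := hn
  have hmem : ∀ (s : T.Top) {x : T.Top}, T.resTop x ∈ P.level ⊥ → T.resTop (s * x) ∈ P.level ⊥ :=
    fun s x hx => by
      rw [map_mul]
      exact Ideal.mul_mem_left _ _ hx
  refine (hP.mem_or_mem hG (hmem s hx) (hmem t hy) ?_).elim hsx hty
  rw [mul_mul_mul_comm]
  exact hst _ (hmem x hy)

theorem not_ker_le_topColon (h : P.topColon ≠ ⊤) : ¬ RingHom.ker T.resTop ≤ P.topColon := by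
  intro hker
  refine h ((Ideal.eq_top_iff_one _).2 fun s hs => ?_)
  rw [one_mul, ← hP.topColon_inf hG]
  refine ⟨(hP.topColon_isPrime hG h).mem_of_pow_mem (Nat.card G) ?_, hs⟩
  have h1 : s ^ Nat.card G - T.nmBot (T.resTop s) ∈ P.topColon := hker (by
    rw [RingHom.mem_ker, map_sub, resTop_nmBot_resTop, sub_self])
  have h2 : T.nmBot (T.resTop s) ∈ P.topColon := P.level_top_le_topColon (P.nm_mem _ hs)
  simpa using add_mem h1 h2

theorem mem_level_bot_of_nmBot_mem (h : P.topColon ≠ ⊤) {N : Ideal T.Bot}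
    (hinv : ∀ (g : G), ∀ a ∈ N, g • a ∈ N) (hN : ∀ a ∈ N, T.nmBot a ∈ P.topColon) :
    N ≤ P.level ⊥ := by
  have hPinv : ∀ (g : G), ∀ a ∈ P.level ⊥, g • a ∈ P.level ⊥ := fun g a ha => P.smul_mem g ha
  refine (hP.le_or_le (ofPair hG (P.level ⊥) ⊤ hPinv (fun _ _ => Submodule.mem_top)
      fun _ _ => Submodule.mem_top)
    (ofPair hG N P.topColon hinv (fun a _ => P.trBot_mem_topColon a) hN) ?_).elim
    (fun h' => absurd ((Ideal.eq_top_iff_one _).2 fun s hs => ?_) h)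
    (fun h' => (ofPair_level_bot hG hinv _ hN).symm.trans_le (h' ⊥))
  · rw [mul_le_iff hG, ofPair_level_bot, ofPair_level_bot, ofPair_level_top, ofPair_level_top]
    refine ⟨Ideal.mul_le_left, Ideal.mul_le.2 fun x hx y hy => ?_⟩
    rw [mul_comm]
    exact hy.1 x hx.2
  · have h1 := h' ⊤
    rw [ofPair_level_top] at h1
    rw [one_mul]
    exact h1 ⟨Submodule.mem_top, hs⟩

end IsPrime

end TambaraIdeal

/-! ### Comparison of the spectrum with the model -/

/-- A surjection `φ` from `T(G/G)` that kills transfers and turns the norm into a ring homomorphism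
`n`, such that the primes over the transfers that do not contain `ker res` come from primes of the
target. -/
structure GeomHom (T : TambaraFunctor.{u} G) {Ψ : Type u} [CommRing Ψ] (φ : T.Top →+* Ψ)
    (n : T.Bot →+* Ψ) : Prop where
  surjective : Function.Surjective φ
  map_tr : ∀ a, φ (T.trBot a) = 0
  map_nm : ∀ a, φ (T.nmBot a) = n a
  ker_le : ∀ q : Ideal T.Top, q.IsPrime → (∀ a, T.trBot a ∈ q) → ¬ RingHom.ker T.resTop ≤ q →
    RingHom.ker φ ≤ q

namespace GeomHom

open TambaraIdeal

variable {Ψ : Type u} [CommRing Ψ] {φ : T.Top →+* Ψ} {n : T.Bot →+* Ψ} (hφ : GeomHom T φ n)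
  (hG : (Nat.card G).Prime)

include hφ

theorem map_smul_eq (g : G) (a : T.Bot) : n (g • a) = n a := by
  rw [← hφ.map_nm, ← hφ.map_nm, nmBot_smul]

include hG

theorem comap_map_topColon {P : T.TambaraIdeal} (hP : P.IsPrime) :
    (P.topColon.map φ).comap φ = P.topColon := by
  rw [Ideal.comap_map_of_surjective' φ hφ.surjective, sup_eq_left]
  by_cases h : P.topColon = ⊤
  · rw [h]
    exact le_top
  · exact hφ.ker_le _ (hP.topColon_isPrime hG h) P.trBot_mem_topColon (hP.not_ker_le_topColon hG h)

theorem exists_model {P : T.TambaraIdeal} (hP : P.IsPrime) :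
    ((P.level ⊥).IsOrbitPrime G ∧ P.topColon.map φ = ⊤) ∨
      ((P.topColon.map φ).IsPrime ∧ P.level ⊥ = (P.topColon.map φ).comap n) := by
  by_cases h : P.topColon = ⊤
  · exact Or.inl ⟨hP.isOrbitPrime_level_bot hG, by rw [h, Ideal.map_top]⟩
  · have := hP.topColon_isPrime hG h
    refine Or.inr ⟨Ideal.map_isPrime_of_surjective hφ.surjective
      (hφ.ker_le _ this P.trBot_mem_topColon (hP.not_ker_le_topColon hG h)), ?_⟩
    have hmem : ∀ a, a ∈ (P.topColon.map φ).comap n ↔ T.nmBot a ∈ P.topColon := fun a => by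
      rw [Ideal.mem_comap, ← hφ.map_nm, ← Ideal.mem_comap, hφ.comap_map_topColon hG hP]
    refine le_antisymm (fun a ha => (hmem a).2 (P.level_top_le_topColon (P.nm_mem _ ha)))
      (hP.mem_level_bot_of_nmBot_mem hG h (fun g a ha => ?_) fun a ha => (hmem a).1 ha)
    rw [Ideal.mem_comap, hφ.map_smul_eq]
    exact ha

theorem topColon_le {P P' : T.TambaraIdeal} (hP' : P'.IsPrime) (h : P ≤ P') :
    P.topColon ≤ P'.topColon := by
  by_cases h' : P'.topColon = ⊤
  · rw [h']
    exact le_top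
  · have hle : P.topColon * (P.level ⊥).comap T.resTop ≤ P'.topColon :=
      Ideal.mul_le.2 fun s hs x hx => P'.level_top_le_topColon (h ⊤ (hs x hx))
    refine ((hP'.topColon_isPrime hG h').mul_le.1 hle).resolve_right fun h'' =>
      hP'.not_ker_le_topColon hG h' (le_trans (fun x hx => ?_) h'')
    rw [Ideal.mem_comap, RingHom.mem_ker.1 hx]
    exact zero_mem _

theorem krullDim_le_model : T.krullDim ≤ Order.krullDim (Ghost.Model G n) := by
  let F : T.Spec → Ghost.Model G n := fun P =>
    ⟨(P.1.level ⊥, P.1.topColon.map φ), hφ.exists_model hG P.2⟩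
  have hF : Monotone F := fun P P' h =>
    ⟨h ⊥, Ideal.map_mono (hφ.topColon_le hG P'.2 h)⟩
  refine Order.krullDim_le_of_strictMono F (hF.strictMono_of_injective fun P P' h => ?_)
  have h1 : P.1.level ⊥ = P'.1.level ⊥ := congrArg (fun x => x.1.1) h
  have h2 : P.1.topColon = P'.1.topColon := by
    rw [← hφ.comap_map_topColon hG P.2, ← hφ.comap_map_topColon hG P'.2]
    exact congrArg (fun x => x.1.2.comap φ) h
  have h3 : P.1.level ⊤ = P'.1.level ⊤ := by
    rw [← P.2.topColon_inf hG, ← P'.2.topColon_inf hG, h1, h2]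
  exact Subtype.ext (le_antisymm ((le_iff hG).2 ⟨h1.le, h3.le⟩) ((le_iff hG).2 ⟨h1.ge, h3.ge⟩))

/-- The ideal of `T` that corresponds to a point of the model. -/
def ofModel (x : Ghost.Model G n) : T.TambaraIdeal :=
  ofPair hG x.1.1 (x.1.2.comap φ) (fun g a ha => x.smul_mem hφ.map_smul_eq g ha)
    (fun a _ => by
      rw [Ideal.mem_comap, hφ.map_tr]
      exact zero_mem _)
    (fun a ha => by
      rw [Ideal.mem_comap, hφ.map_nm]
      exact x.le_comap ha)

theorem ofModel_level_bot (x : Ghost.Model G n) : (hφ.ofModel hG x).level ⊥ = x.1.1 :=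
  ofPair_level_bot ..

theorem ofModel_level_top (x : Ghost.Model G n) :
    (hφ.ofModel hG x).level ⊤ = x.1.2.comap φ ⊓ x.1.1.comap T.resTop :=
  ofPair_level_top ..

theorem ofModel_isPrime (x : Ghost.Model G n) : (hφ.ofModel hG x).IsPrime := by
  rcases x.2 with ⟨h1, h2⟩ | ⟨h1, h2⟩
  · refine ⟨⟨⊥, by rw [ofModel_level_bot]; exact h1.ne_top⟩, fun I J hIJ => ?_⟩
    rw [mul_le_iff hG, ofModel_level_bot] at hIJ
    have key : ∀ I : T.TambaraIdeal, I.level ⊥ ≤ x.1.1 → I ≤ hφ.ofModel hG x := fun I h => by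
      rw [le_iff hG, ofModel_level_bot, ofModel_level_top, h2, Ideal.comap_top, top_inf_eq]
      exact ⟨h, I.level_top_le_comap.trans (Ideal.comap_mono h)⟩
    exact (h1.le_or_le (fun g a ha => I.smul_mem g ha) (fun g a ha => J.smul_mem g ha) hIJ.1).imp
      (key I) (key J)
  · have hp : x.1.1.IsPrime := by
      rw [h2]
      exact Ideal.IsPrime.comap n
    refine ⟨⟨⊥, by rw [ofModel_level_bot]; exact hp.ne_top⟩, fun I J hIJ => ?_⟩
    rw [mul_le_iff hG, ofModel_level_bot, ofModel_level_top] at hIJ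
    have hnm : ∀ I : T.TambaraIdeal, I.level ⊤ ≤ x.1.2.comap φ → I.level ⊥ ≤ x.1.1 :=
      fun I h a ha => by
        rw [h2, Ideal.mem_comap, ← hφ.map_nm]
        exact h (I.nm_mem _ ha)
    have key : ∀ I : T.TambaraIdeal, I.level ⊤ ≤ x.1.2.comap φ → I ≤ hφ.ofModel hG x :=
      fun I h => by
        rw [le_iff hG, ofModel_level_bot, ofModel_level_top]
        exact ⟨hnm I h, le_inf h (I.level_top_le_comap.trans (Ideal.comap_mono (hnm I h)))⟩
    exact ((h1.comap φ).mul_le.1 (hIJ.2.trans inf_le_left)).imp (key I) (key J)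

theorem model_krullDim_le (hres : ∀ b : Ψ, ∃ s, T.resTop s = 0 ∧ φ s = b) :
    Order.krullDim (Ghost.Model G n) ≤ T.krullDim := by
  have hle : ∀ x y, hφ.ofModel hG x ≤ hφ.ofModel hG y ↔ x ≤ y := by
    intro x y
    rw [le_iff hG, ofModel_level_bot, ofModel_level_bot, ofModel_level_top, ofModel_level_top]
    refine ⟨fun h => ⟨h.1, fun b hb => ?_⟩, fun h => ⟨h.1, inf_le_inf (Ideal.comap_mono h.2)
      (Ideal.comap_mono h.1)⟩⟩
    obtain ⟨s, hs, rfl⟩ := hres b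
    refine (h.2 ⟨hb, ?_⟩).1
    change T.resTop s ∈ x.1.1
    rw [hs]
    exact zero_mem _
  refine Order.krullDim_le_of_strictMono
    (fun x => (⟨hφ.ofModel hG x, hφ.ofModel_isPrime hG x⟩ : T.Spec)) fun x y h => ?_
  exact lt_of_le_not_ge ((hle x y).2 h.le) fun h' => h.not_ge ((hle y x).1 h')

end GeomHom

end TambaraFunctor

namespace TambaraFunctor

open GSet

variable {G : Type} [Group G] [Finite G] (T : TambaraFunctor.{u} G) (hG : (Nat.card G).Prime)

theorem geomHom_mk : GeomHom T (Ideal.Quotient.mk T.trIdeal) (T.nmGeom hG) where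
  surjective := Ideal.Quotient.mk_surjective
  map_tr a := Ideal.Quotient.eq_zero_iff_mem.2 ⟨a, rfl⟩
  map_nm _ := rfl
  ker_le q _ htr _ := by
    rw [Ideal.mk_ker]
    rintro _ ⟨a, rfl⟩
    exact htr a

/-- The projection `gh(T)(G/G) → Φ^G T`. -/
noncomputable def ghostSnd : (T.ghost hG).Top →+* T.GeomFixed :=
  (RingHom.snd _ _).comp (T.ghostTop hG).toRingHom

theorem ghostBot_resTop (v : (T.ghost hG).Top) :
    T.ghostBot hG ((T.ghost hG).resTop v) = (T.ghostTop hG v).1 := rfl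

theorem exists_ghostTop_eq (b : T.GeomFixed) :
    ∃ v : (T.ghost hG).Top, (T.ghost hG).resTop v = 0 ∧ T.ghostSnd hG v = b := by
  refine ⟨(T.ghostTop hG).symm (0, b), (T.ghostBot hG).injective ?_, ?_⟩
  · rw [ghostBot_resTop, RingEquiv.apply_symm_apply, map_zero]
    rfl
  · change ((T.ghostTop hG) ((T.ghostTop hG).symm (0, b))).2 = b
    rw [RingEquiv.apply_symm_apply]

theorem geomHom_ghostSnd : GeomHom (T.ghost hG) (T.ghostSnd hG)
    ((T.nmGeom hG).comp (T.ghostBot hG).toRingHom) where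
  surjective b := by
    obtain ⟨v, -, hv⟩ := T.exists_ghostTop_eq hG b
    exact ⟨v, hv⟩
  map_tr a := (T.ghostTop_tr hG a).2
  map_nm a := (T.ghostTop_nm hG a).2
  ker_le q hq _ hker v hv := by
    obtain ⟨w, hw, hwq⟩ := SetLike.not_le_iff_exists.1 hker
    refine (hq.mem_or_mem (x := v) (y := w) ?_).resolve_right hwq
    have h1 : (T.ghostTop hG v).2 = 0 := hv
    have h2 : ((T.ghostTop hG w).1 : T.Bot) = 0 := by
      rw [← ghostBot_resTop, RingHom.mem_ker.1 hw, map_zero]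
    have h3 : v * w = 0 := by
      apply (T.ghostTop hG).injective
      rw [map_mul, map_zero]
      refine Prod.ext (Subtype.ext ?_) ?_
      · change ((T.ghostTop hG v).1 : T.Bot) * (T.ghostTop hG w).1 = 0
        rw [h2, mul_zero]
      · change (T.ghostTop hG v).2 * (T.ghostTop hG w).2 = 0
        rw [h1, zero_mul]
    rw [h3]
    exact q.zero_mem

theorem krullDim_le_krullDim_ghost : T.krullDim ≤ (T.ghost hG).krullDim :=
  ((T.geomHom_mk hG).krullDim_le_model hG).trans
    ((Ghost.Model.krullDim_le_of_ringEquiv (T.ghostBot hG) (T.ghostBot_smul hG)).trans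
      ((T.geomHom_ghostSnd hG).model_krullDim_le hG (T.exists_ghostTop_eq hG)))

theorem krullDim_ghost_le (hint : (T.nmGeom hG).IsIntegral) :
    (T.ghost hG).krullDim ≤ max (ringKrullDim T.Bot) (ringKrullDim T.GeomFixed + 1) := by
  rw [← ringKrullDim_eq_of_ringEquiv (T.ghostBot hG)]
  refine ((T.geomHom_ghostSnd hG).krullDim_le_model hG).trans (Ghost.Model.krullDim_le ?_)
  exact RingHom.IsIntegral.trans _ _
    (RingHom.isIntegral_of_surjective _ (T.ghostBot hG).surjective) hint

end TambaraFunctor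

theorem mainTheorem8 {G : Type} [Group G] [Finite G] (hG : (Nat.card G).Prime)
    (T : TambaraFunctor.{u} G) (hint : (T.nmGeom hG).IsIntegral) :
    (T.krullDim ≤ (T.ghost hG).krullDim ∧
      (T.ghost hG).krullDim ≤
        max (ringKrullDim (T.obj (G ⧸ (⊥ : Subgroup G)))) (ringKrullDim T.GeomFixed + 1)) ∧
    (Function.Injective (T.nmGeom hG) →
      ringKrullDim (T.obj (G ⧸ (⊥ : Subgroup G))) = ringKrullDim T.GeomFixed ∧
      T.krullDim ≤ ringKrullDim (T.obj (G ⧸ (⊥ : Subgroup G))) + 1) := by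
  have h1 := T.krullDim_le_krullDim_ghost hG
  have h2 := T.krullDim_ghost_le hG hint
  refine ⟨⟨h1, h2⟩, fun hinj => ?_⟩
  have h3 := hint.ringKrullDim_eq hinj
  refine ⟨h3, (h1.trans h2).trans ?_⟩
  rw [h3]
  exact max_le (le_add_of_nonneg_right zero_le_one) le_rfl
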